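/- Let $A,B,A',B',R_A,R_B$ be finite-dimensional quantum systems and let $U$ be a unitary from $\mathcal H_A\otimes\mathcal H_B$ onto $\mathcal H_{A'}\otimes\mathcal H_{B'}$. Let $\psi_{AR_A}$ and $\phi_{BR_B}$ be pure states (also denoting their projectors), $\rho_A=\operatorname{Tr}_{R_A}\psi_{AR_A}$, $\rho_B=\operatorname{Tr}_{R_B}\phi_{BR_B}$, and let $X_A,X_B,X_{A'},X_{B'}$ be Hermitian operators on the indicated systems with the conservation law $$U(X_A\otimes 1+1\otimes X_B)U^\dagger=X_{A'}\otimes 1+1\otimes X_{B'} .$$ For density operators let $F(\rho,\sigma)=\operatorname{Tr}\sqrt{\sqrt\sigma\rho\sqrt\sigma}$ and $D_F(\rho,\sigma)=\sqrt{1-F(\rho,\sigma)^2}$, and let $$\mathcal F_\rho(X)=4\lim_{\epsilon\to0}\frac{D_F(e^{-iX\epsilon}\rho e^{iX\epsilon},\rho)^2}{\epsilon^2}$$ be the quantum Fisher information. Define the recovery error $$\delta=\min_{\mathcal R}D_F\big(\psi_{AR_A},(\mathcal R\otimes\mathrm{id}_{R_A})(\operatorname{Tr}_{B'}[U(\psi_{AR_A}\otimes\phi_{BR_B})U^\dagger])\big),$$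 where $\mathcal R$ runs over the completely positive trace preserving maps from $A'R_B$ to $A$. Let $\mathcal E(\rho)=\operatorname{Tr}_{B'}[U(\rho\otimes\rho_B)U^\dagger]$, $\langle X\rangle_\rho=\operatorname{Tr}(X\rho)$. For a decomposition $\rho_A=\sum_jp_j\rho_j$ into finitely many density operators $\rho_j$ with weights $p_j>0$, $\sum_jp_j=1$, put $$\Delta_j=\big(\langle X_A\rangle_{\rho_j}-\langle X_{A'}\rangle_{\mathcal E(\rho_j)}\big)-\big(\langle X_A\rangle_{\rho_A}-\langle X_{A'}\rangle_{\mathcal E(\rho_A)}\big).$$ Over all such decompositions (and, where $j$ is free, all their members $j$) let $$\mathcal A=\max\sum_jp_j|\Delta_j|,\qquad \mathcal A_1=\max p_j|\Delta_j|,\qquad \Delta_{\max}=\max|\Delta_j| .$$ Let $\sigma_{B'R'}$ be any purification, on $B'R'$ with a finite-dimensional reference $R'$, of the final state $\operatorname{Tr}_{A'}[U(\rho_A\otimes\rho_B)U^\dagger]$ of $B'$, and $\mathcal F_f=\mathcal F_{\sigma_{B'R'}}(X_{B'}\otimes1_{R'})$. Then the minimum defining $\delta$, the maxima defining $\mathcal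 A$, $\mathcal A_1$, $\Delta_{\max}$ and the limit defining $\mathcal F_f$ all exist, and $$\frac{\mathcal A}{2(\sqrt{\mathcal F_f}+\Delta_{\max})}\le\delta\qquad\text{and}\qquad\frac{\mathcal A_1}{2(\sqrt{\mathcal F_f}+\Delta_{\max})}\le\delta ,$$ where the left-hand sides are read as $0$ if $\sqrt{\mathcal F_f}+\Delta_{\max}=0$ (in which case $\mathcal A=\mathcal A_1=0$). -/

import Mathlib

open Filter Topology
open scoped Matrix Kronecker ComplexOrder MatrixOrder

namespace QRecovery

/-! Finite dimensional systems are modelled by finite index types (an orthonormal basis);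
operators are complex matrices, and a composite system is indexed by the product type. -/

section Basic

variable {m n k : Type*} [Fintype m] [Fintype n]

/-- A unit vector. -/
def IsUnitVector (ψ : m → ℂ) : Prop := star ψ ⬝ᵥ ψ = 1

/-- The rank-one operator `|ψ⟩⟨ψ|`. -/
def pureState (ψ : m → ℂ) : Matrix m m ℂ := Matrix.vecMulVec ψ (star ψ)

/-- Density operators. -/
def IsDensity (ρ : Matrix m m ℂ) : Prop := ρ.PosSemidef ∧ ρ.trace = 1

/-- Partial trace over the second tensor factor. -/
def traceSnd (M : Matrix (m × n) (m × n) ℂ) : Matrix m m ℂ :=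
  Matrix.of fun i j => ∑ x, M (i, x) (j, x)

/-- Partial trace over the first tensor factor. -/
def traceFst (M : Matrix (m × n) (m × n) ℂ) : Matrix n n ℂ :=
  Matrix.of fun i j => ∑ x, M (x, i) (x, j)

/-- The map `Φ ⊗ id` on operators of a composite system. -/
def tensorId (Φ : Matrix m m ℂ →ₗ[ℂ] Matrix n n ℂ) (M : Matrix (m × k) (m × k) ℂ) :
    Matrix (n × k) (n × k) ℂ :=
  Matrix.of fun x y => Φ (Matrix.of fun a b => M (a, x.2) (b, y.2)) x.1 y.1

/-- Completely positive and trace preserving maps. -/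
def IsCPTP (Φ : Matrix m m ℂ →ₗ[ℂ] Matrix n n ℂ) : Prop :=
  (∀ (d : ℕ) (M : Matrix (m × Fin d) (m × Fin d) ℂ),
      M.PosSemidef → (tensorId Φ M).PosSemidef) ∧
  ∀ M : Matrix m m ℂ, (Φ M).trace = M.trace

/-- The expectation value `Tr (X ρ)`; it is real for Hermitian `X` and `ρ`. -/
noncomputable def expect (X ρ : Matrix m m ℂ) : ℝ := (X * ρ).trace.re

variable [DecidableEq m]

/-- Uhlmann fidelity `Tr √(√σ ρ √σ)`. -/
noncomputable def fidelity (ρ σ : Matrix m m ℂ) : ℝ :=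
  (CFC.sqrt (CFC.sqrt σ * ρ * CFC.sqrt σ)).trace.re

/-- Purified distance. -/
noncomputable def purifiedDist (ρ σ : Matrix m m ℂ) : ℝ := Real.sqrt (1 - fidelity ρ σ ^ 2)

/-- The quotient whose limit at `ε → 0` is a quarter of the quantum Fisher information. -/
noncomputable def fisherQuotient (ρ X : Matrix m m ℂ) (ε : ℝ) : ℝ :=
  purifiedDist
    (NormedSpace.exp ((-(Complex.I * ε)) • X) * ρ * NormedSpace.exp ((Complex.I * ε) • X)) ρ ^ 2
    / ε ^ 2

/-- Quantum Fisher information of `ρ` with respect to `X`. -/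
noncomputable def fisherInfo (ρ X : Matrix m m ℂ) : ℝ :=
  4 * limUnder (𝓝[≠] (0 : ℝ)) (fisherQuotient ρ X)

end Basic

/-- `ρ = ∑ j, p j • ρs j` is a decomposition of `ρ` into density operators `ρs j` which occur with
(nonzero) probabilities `p j`. -/
def IsDecomposition {m : Type*} [Fintype m] (ρ : Matrix m m ℂ) (d : ℕ) (p : Fin d → ℝ)
    (ρs : Fin d → Matrix m m ℂ) : Prop :=
  (∀ j, 0 < p j) ∧ ∑ j, p j = 1 ∧ (∀ j, IsDensity (ρs j)) ∧ ρ = ∑ j, (p j : ℂ) • ρs j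

section Setup

variable {A B A' B' RA RB : Type*}
  [Fintype A] [Fintype B] [Fintype A'] [Fintype B'] [Fintype RA] [Fintype RB]

/-- `U (ρ ⊗ σ) U†`, where `U` maps the space of `AB` onto that of `A'B'`. -/
def evolve (U : Matrix (A' × B') (A × B) ℂ) (ρ : Matrix A A ℂ) (σ : Matrix B B ℂ) :
    Matrix (A' × B') (A' × B') ℂ :=
  U * (ρ ⊗ₖ σ) * Uᴴ

/-- The channel `ρ ↦ Tr_{B'} (U (ρ ⊗ ρB) U†)` from `A` to `A'`. -/
def channel (U : Matrix (A' × B') (A × B) ℂ) (ρB : Matrix B B ℂ) (ρ : Matrix A A ℂ) :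
    Matrix A' A' ℂ :=
  traceSnd (evolve U ρ ρB)

/-- The total final state `(U ⊗ 1) (ψ ⊗ φ) (U ⊗ 1)†`, with the tensor factors in the order
`A', B', RA, RB`. -/
def totalFinal [DecidableEq RA] [DecidableEq RB] (U : Matrix (A' × B') (A × B) ℂ)
    (ψ : A × RA → ℂ) (φ : B × RB → ℂ) :
    Matrix ((A' × B') × (RA × RB)) ((A' × B') × (RA × RB)) ℂ :=
  (U ⊗ₖ (1 : Matrix (RA × RB) (RA × RB) ℂ)) *
    (pureState ψ ⊗ₖ pureState φ).submatrix
      (Equiv.prodProdProdComm A B RA RB) (Equiv.prodProdProdComm A B RA RB) *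
    (U ⊗ₖ (1 : Matrix (RA × RB) (RA × RB) ℂ))ᴴ

/-- The partial trace over `B'` of the total final state, with the tensor factors in the order
`A', RB, RA`. -/
def accessibleFinal [DecidableEq RA] [DecidableEq RB] (U : Matrix (A' × B') (A × B) ℂ)
    (ψ : A × RA → ℂ) (φ : B × RB → ℂ) :
    Matrix ((A' × RB) × RA) ((A' × RB) × RA) ℂ :=
  traceSnd ((totalFinal U ψ φ).submatrix
    (fun x : ((A' × RB) × RA) × B' => ((x.1.1.1, x.2), (x.1.2, x.1.1.2)))
    (fun x : ((A' × RB) × RA) × B' => ((x.1.1.1, x.2), (x.1.2, x.1.1.2))))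

/-- The errors of all recovery channels from `A' RB` to `A`. -/
def recoveryErrors [DecidableEq A] [DecidableEq RA] [DecidableEq RB]
    (U : Matrix (A' × B') (A × B) ℂ) (ψ : A × RA → ℂ) (φ : B × RB → ℂ) : Set ℝ :=
  {x | ∃ R : Matrix (A' × RB) (A' × RB) ℂ →ₗ[ℂ] Matrix A A ℂ,
    IsCPTP R ∧ x = purifiedDist (pureState ψ) (tensorId R (accessibleFinal U ψ φ))}

/-- The recovery error `δ`. -/
noncomputable def recoveryError [DecidableEq A] [DecidableEq RA] [DecidableEq RB]
    (U : Matrix (A' × B') (A × B) ℂ) (ψ : A × RA → ℂ) (φ : B × RB → ℂ) : ℝ :=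
  sInf (recoveryErrors U ψ φ)

/-- `Δ_j` for the member `ρj` of a decomposition of `ρA`. -/
noncomputable def deviation (U : Matrix (A' × B') (A × B) ℂ) (ρB : Matrix B B ℂ)
    (XA : Matrix A A ℂ) (XA' : Matrix A' A' ℂ) (ρA ρj : Matrix A A ℂ) : ℝ :=
  (expect XA ρj - expect XA' (channel U ρB ρj)) - (expect XA ρA - expect XA' (channel U ρB ρA))

/-- All values of `∑ j, p j |Δ_j|` over the decompositions of `ρA`. -/
def sumValues (U : Matrix (A' × B') (A × B) ℂ) (ρB : Matrix B B ℂ)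
    (XA : Matrix A A ℂ) (XA' : Matrix A' A' ℂ) (ρA : Matrix A A ℂ) : Set ℝ :=
  {x | ∃ (d : ℕ) (p : Fin d → ℝ) (ρs : Fin d → Matrix A A ℂ), IsDecomposition ρA d p ρs ∧
    x = ∑ j, p j * |deviation U ρB XA XA' ρA (ρs j)|}

/-- All values of `p j |Δ_j|` over the decompositions of `ρA` and their members. -/
def termValues (U : Matrix (A' × B') (A × B) ℂ) (ρB : Matrix B B ℂ)
    (XA : Matrix A A ℂ) (XA' : Matrix A' A' ℂ) (ρA : Matrix A A ℂ) : Set ℝ :=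
  {x | ∃ (d : ℕ) (p : Fin d → ℝ) (ρs : Fin d → Matrix A A ℂ), IsDecomposition ρA d p ρs ∧
    ∃ j, x = p j * |deviation U ρB XA XA' ρA (ρs j)|}

/-- All values of `|Δ_j|` over the decompositions of `ρA` and their members. -/
def deviationValues (U : Matrix (A' × B') (A × B) ℂ) (ρB : Matrix B B ℂ)
    (XA : Matrix A A ℂ) (XA' : Matrix A' A' ℂ) (ρA : Matrix A A ℂ) : Set ℝ :=
  {x | ∃ (d : ℕ) (p : Fin d → ℝ) (ρs : Fin d → Matrix A A ℂ), IsDecomposition ρA d p ρs ∧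
    ∃ j, x = |deviation U ρB XA XA' ρA (ρs j)|}

/-- The dynamical fluctuation, as the maximum of `∑ j, p j |Δ_j|`. -/
noncomputable def fluctuationSum (U : Matrix (A' × B') (A × B) ℂ) (ρB : Matrix B B ℂ)
    (XA : Matrix A A ℂ) (XA' : Matrix A' A' ℂ) (ρA : Matrix A A ℂ) : ℝ :=
  sSup (sumValues U ρB XA XA' ρA)

/-- The dynamical fluctuation, as the maximum of the single terms `p j |Δ_j|`. -/
noncomputable def fluctuationTerm (U : Matrix (A' × B') (A × B) ℂ) (ρB : Matrix B B ℂ)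
    (XA : Matrix A A ℂ) (XA' : Matrix A' A' ℂ) (ρA : Matrix A A ℂ) : ℝ :=
  sSup (termValues U ρB XA XA' ρA)

/-- The quantity `Δ_max`. -/
noncomputable def deltaMax (U : Matrix (A' × B') (A × B) ℂ) (ρB : Matrix B B ℂ)
    (XA : Matrix A A ℂ) (XA' : Matrix A' A' ℂ) (ρA : Matrix A A ℂ) : ℝ :=
  sSup (deviationValues U ρB XA XA' ρA)

end Setup

end QRecovery

open QRecovery

/-! The deviations $\Delta_j$ are recorded in the environment $B'$, and good recovery of a pure
state of $AR_A$ leaves no correlation between $R_A$ and $B'$.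

By the conservation law, $M\mapsto\Delta$ extends to a linear functional
$G(M)=\operatorname{Tr}(Z\,\mathcal E'(M))$, where $\mathcal E'$ is the complementary channel to
$B'$ and $Z$ is $X_{B'}$ centred in its final state (`deviationMap_eq`). As $G(\rho_A)=0$, both
fluctuations come from one maximiser $M$ of $G$ over $0\le M\le\rho_A$: $\mathcal A=2G(M)$ and
$\mathcal A_1=G(M)$ (`exists_isGreatest_decomposition`).

Write $\rho_A=\Psi\Psi^\dagger$, with $\Psi$ the coefficient matrix of $\psi$. Then $M=\Psi
E\Psi^\dagger$ for an effect $E$ (`exists_effect`), and with the contraction $W=2E-1$ the number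
$2G(M)$ is the correlation of $W^T$ on $R_A$ with $Z$ on $B'$ (`trace_recoveredFinal_mul`). Recovery
acts on $A'R_B$ only and leaves it unchanged. If the recovered state were exactly $\psi$ on $AR_A$,
the correlation would factorise and vanish, $Z$ being centred. In general `trace_correlation_le`
bounds it by $4\delta\sqrt{\operatorname{Var}(X_{B'})}$, since $\delta^2$ is the weight outside
$\psi$.

For a purification $\sqrt{\mathcal F_f}$ is twice the standard deviation, so $\mathcal
A\le2\delta\sqrt{\mathcal F_f}$; adding $\Delta_{\max}$ only weakens this. The extrema exist by
compactness, of Choi matrices for $\delta$ and of sets of positive matrices for the maxima. -/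

namespace QRecovery

/-! ### Cauchy–Schwarz and the correlation bound -/

section Weighted

variable {m n : Type*} [Fintype m] [Fintype n]

/-- Cauchy–Schwarz inequality for the Hilbert–Schmidt inner product. -/
theorem norm_trace_conjTranspose_mul_le (M N : Matrix m n ℂ) :
    ‖(Mᴴ * N).trace‖ ≤ Real.sqrt (Mᴴ * M).trace.re * Real.sqrt (Nᴴ * N).trace.re := by
  have key : ∀ K : Matrix m n ℂ, (Kᴴ * K).trace.re = ∑ x : n × m, ‖K x.2 x.1‖ ^ 2 := by
    intro K
    simp only [Matrix.trace, Matrix.diag_apply, Matrix.mul_apply, Matrix.conjTranspose_apply,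
      Complex.re_sum, Fintype.sum_prod_type]
    refine Finset.sum_congr rfl fun j _ => Finset.sum_congr rfl fun i _ => ?_
    rw [← Complex.normSq_eq_norm_sq, Complex.normSq_apply]
    simp
  rw [key, key]
  refine le_trans ?_ (Real.sum_mul_le_sqrt_mul_sqrt _ _ _)
  simp only [Matrix.trace, Matrix.diag_apply, Matrix.mul_apply, Matrix.conjTranspose_apply]
  rw [Fintype.sum_prod_type]
  refine (norm_sum_le _ _).trans (Finset.sum_le_sum fun j _ => (norm_sum_le _ _).trans
    (Finset.sum_le_sum fun i _ => ?_))
  simp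

variable [DecidableEq m]

theorem exists_eq_conjTranspose_mul_self {ω : Matrix m m ℂ} (hω : ω.PosSemidef) :
    ∃ B : Matrix m m ℂ, ω = Bᴴ * B :=
  CStarAlgebra.nonneg_iff_eq_star_mul_self.1 hω.nonneg

/-- Cauchy–Schwarz inequality for the inner product `Tr (ω M† N)`. -/
theorem norm_trace_mul_le {ω : Matrix m m ℂ} (hω : ω.PosSemidef) (M N : Matrix m m ℂ) :
    ‖(ω * (Mᴴ * N)).trace‖ ≤
      Real.sqrt (ω * (Mᴴ * M)).trace.re * Real.sqrt (ω * (Nᴴ * N)).trace.re := by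
  obtain ⟨B, rfl⟩ := exists_eq_conjTranspose_mul_self hω
  have key : ∀ K L : Matrix m m ℂ, (Bᴴ * B * (Kᴴ * L)).trace = ((K * Bᴴ)ᴴ * (L * Bᴴ)).trace := by
    intro K L
    rw [Matrix.conjTranspose_mul, Matrix.conjTranspose_conjTranspose, Matrix.mul_assoc,
      Matrix.trace_mul_comm]
    simp only [Matrix.mul_assoc]
  rw [key, key, key]
  exact norm_trace_conjTranspose_mul_le _ _

theorem trace_mul_nonneg {ω K : Matrix m m ℂ} (hω : ω.PosSemidef) (hK : K.PosSemidef) :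
    0 ≤ (ω * K).trace := by
  obtain ⟨B, rfl⟩ := exists_eq_conjTranspose_mul_self hω
  rw [Matrix.mul_assoc, Matrix.trace_mul_comm]
  exact (hK.mul_mul_conjTranspose_same B).trace_nonneg

theorem trace_mul_re_mono {ω K L : Matrix m m ℂ} (hω : ω.PosSemidef) (h : (L - K).PosSemidef) :
    (ω * K).trace.re ≤ (ω * L).trace.re := by
  have := (Complex.le_def.1 (trace_mul_nonneg hω h)).1
  rw [Matrix.mul_sub, Matrix.trace_sub] at this
  simpa using this

/-- If the block of `O` on the range of the projection `Q` is the scalar `o`, then the correlation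
of `O` with a centred observable `Z` commuting with `O` and `Q` is controlled by the weight of the
state outside of the range of `Q`. -/
theorem trace_correlation_le {ω Q Z O : Matrix m m ℂ} {o : ℝ} (hω : ω.PosSemidef)
    (hQ : Q.IsHermitian) (hQQ : Q * Q = Q) (hZ : Z.IsHermitian) (hO : O.IsHermitian)
    (hZQ : Z * Q = Q * Z) (hZO : Z * O = O * Z) (hQOQ : Q * O * Q = (o : ℂ) • Q) (ho : |o| ≤ 1)
    (hOO : (1 - O * O).PosSemidef) (hmean : (ω * Z).trace = 0) :
    (ω * (Z * O)).trace.re ≤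
      4 * Real.sqrt (ω * (1 - Q)).trace.re * Real.sqrt (ω * (Z * Z)).trace.re := by
  set P := 1 - Q with hP
  have hPh : P.IsHermitian := Matrix.isHermitian_one.sub hQ
  have hPP : P * P = P := by
    simp [hP, Matrix.mul_sub, Matrix.sub_mul, hQQ]
  have hQP : Q * P = 0 := by simp [hP, Matrix.mul_sub, hQQ]
  have hZP : Z * P = P * Z := by simp [hP, Matrix.mul_sub, Matrix.sub_mul, hZQ]
  set V := Real.sqrt (ω * (Z * Z)).trace.re
  set D := Real.sqrt (ω * P).trace.re
  have hV0 : 0 ≤ V := Real.sqrt_nonneg _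
  have hD0 : 0 ≤ D := Real.sqrt_nonneg _
  have hpos : ∀ K : Matrix m m ℂ, (Kᴴ * K).PosSemidef := Matrix.posSemidef_conjTranspose_mul_self
  have hZZQ : (Z * Q)ᴴ * (Z * Q) = Q * (Z * Z) * Q := by
    rw [Matrix.conjTranspose_mul, hZ.eq, hQ.eq]; simp only [Matrix.mul_assoc]
  have hZZP : (Z * P)ᴴ * (Z * P) = P * (Z * Z) * P := by
    rw [Matrix.conjTranspose_mul, hZ.eq, hPh.eq]; simp only [Matrix.mul_assoc]
  -- `Z` commutes with `Q`, so its square has no cross terms; each compression therefore has second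
  -- moment at most that of `Z`.
  have hsplit : Z * Z = (Z * Q)ᴴ * (Z * Q) + (Z * P)ᴴ * (Z * P) := by
    have e1 : Q * (Z * Z) * Q = Z * Z * Q := by
      rw [← Matrix.mul_assoc, ← hZQ, Matrix.mul_assoc Z Q, ← hZQ, ← Matrix.mul_assoc,
        Matrix.mul_assoc _ Q Q, hQQ]
    have e2 : P * (Z * Z) * P = Z * Z * P := by
      rw [← Matrix.mul_assoc, ← hZP, Matrix.mul_assoc Z P, ← hZP, ← Matrix.mul_assoc,
        Matrix.mul_assoc _ P P, hPP]
    rw [hZZQ, hZZP, e1, e2, ← Matrix.mul_add, hP]; simp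
  have hVQ : Real.sqrt (ω * ((Z * Q)ᴴ * (Z * Q))).trace.re ≤ V :=
    Real.sqrt_le_sqrt (trace_mul_re_mono hω (by
      conv => arg 1; arg 1; rw [hsplit]
      simpa using hpos (Z * P)))
  have hVP : Real.sqrt (ω * ((Z * P)ᴴ * (Z * P))).trace.re ≤ V :=
    Real.sqrt_le_sqrt (trace_mul_re_mono hω (by
      conv => arg 1; arg 1; rw [hsplit]
      simpa using hpos (Z * Q)))
  have hDP : Real.sqrt (ω * (Pᴴ * P)).trace.re = D := by rw [hPh.eq, hPP]
  have hDO : Real.sqrt (ω * ((O * P)ᴴ * (O * P))).trace.re ≤ D := by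
    refine Real.sqrt_le_sqrt (trace_mul_re_mono hω ?_)
    have := hOO.conjTranspose_mul_mul_same P
    rw [Matrix.mul_sub Pᴴ, Matrix.sub_mul (Pᴴ * 1), hPh.eq, Matrix.mul_one, hPP] at this
    rw [Matrix.conjTranspose_mul, hO.eq, hPh.eq]
    simpa only [Matrix.mul_assoc] using this
  have cs : ∀ K L : Matrix m m ℂ, ∀ a b : ℝ, Real.sqrt (ω * (Kᴴ * K)).trace.re ≤ a →
      Real.sqrt (ω * (Lᴴ * L)).trace.re ≤ b → 0 ≤ a → ‖(ω * (Kᴴ * L)).trace‖ ≤ a * b :=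
    fun K L a b h1 h2 h3 => (norm_trace_mul_le hω K L).trans
      (mul_le_mul h1 h2 (Real.sqrt_nonneg _) h3)
  have t1 := cs (Z * Q) (O * P) V D hVQ hDO hV0
  have t2 := cs (O * P) (Z * Q) D V hDO hVQ hD0
  have t3 := cs (Z * P) (O * P) V D hVP hDO hV0
  have t4 := cs (Z * P) P V D hVP hDP.le hV0
  have hZQP : Q * Z * P = 0 := by rw [← hZQ, Matrix.mul_assoc, hQP, Matrix.mul_zero]
  -- Block expansion along `Q + P = 1`. The `Q`–`Q` block is `o • (Z - P * Z * P)`; centring kills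
  -- `o • Z`, and each of the four remaining terms is at most `V * D`, whence the constant 4.
  have dec : Z * O = (o : ℂ) • Z - (o : ℂ) • ((Z * P)ᴴ * P) + (Z * Q)ᴴ * (O * P)
      + (O * P)ᴴ * (Z * Q) + (Z * P)ᴴ * (O * P) := by
    simp only [Matrix.conjTranspose_mul, hZ.eq, hO.eq, hQ.eq, hPh.eq]
    have e1 : (o : ℂ) • Z - (o : ℂ) • (P * Z * P) = Q * Z * (O * Q) := by
      rw [← hZP, Matrix.mul_assoc Z P P, hPP, ← smul_sub]
      have : Z - Z * P = Z * Q := by rw [hP, Matrix.mul_sub]; simp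
      rw [this, ← hZQ, Matrix.mul_assoc, ← Matrix.mul_assoc Q O Q, hQOQ, Matrix.mul_smul]
    rw [e1]
    have e2 : P * O * (Z * Q) = P * Z * (O * Q) := by
      rw [Matrix.mul_assoc, ← Matrix.mul_assoc O, ← hZO]; simp only [Matrix.mul_assoc]
    rw [e2]
    calc Z * O = (Q + P) * Z * (O * (Q + P)) := by rw [hP]; simp
      _ = _ := by simp only [Matrix.add_mul, Matrix.mul_add]; abel
  have tr : (ω * (Z * O)).trace = -((o : ℂ) * (ω * ((Z * P)ᴴ * P)).trace)
      + (ω * ((Z * Q)ᴴ * (O * P))).trace + (ω * ((O * P)ᴴ * (Z * Q))).trace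
      + (ω * ((Z * P)ᴴ * (O * P))).trace := by
    rw [dec]
    simp only [Matrix.mul_add, Matrix.mul_sub, Matrix.mul_smul, Matrix.trace_add,
      Matrix.trace_sub, Matrix.trace_smul, hmean, smul_eq_mul]
    ring
  have t4' : ‖-((o : ℂ) * (ω * ((Z * P)ᴴ * P)).trace)‖ ≤ V * D := by
    rw [norm_neg, norm_mul, Complex.norm_real, Real.norm_eq_abs]
    calc |o| * _ ≤ 1 * (V * D) := mul_le_mul ho t4 (norm_nonneg _) zero_le_one
      _ = V * D := one_mul _
  rw [tr]
  have r : ∀ z : ℂ, z.re ≤ ‖z‖ := Complex.re_le_norm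
  simp only [Complex.add_re]
  linarith [(r _).trans t1, (r _).trans t2, (r _).trans t3, (r _).trans t4']

end Weighted

/-! ### Fidelity and purified distance for a pure state -/

section Fidelity

variable {m : Type*} [Fintype m]

theorem pureState_posSemidef (ψ : m → ℂ) : (pureState ψ).PosSemidef :=
  Matrix.posSemidef_vecMulVec_self_star ψ

theorem pureState_mul_mul_pureState (ψ : m → ℂ) (K : Matrix m m ℂ) :
    pureState ψ * K * pureState ψ = (star ψ ⬝ᵥ K *ᵥ ψ) • pureState ψ := by
  simp only [pureState, Matrix.vecMulVec_mul, Matrix.dotProduct_mulVec]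
  rw [Matrix.vecMul_vecMulVec, Matrix.vecMulVec_smul]

theorem trace_mul_pureState (K : Matrix m m ℂ) (ψ : m → ℂ) :
    (K * pureState ψ).trace = star ψ ⬝ᵥ K *ᵥ ψ := by
  rw [pureState, Matrix.mul_vecMulVec, Matrix.trace_vecMulVec, dotProduct_comm]

variable [DecidableEq m]

/-- The square of $|v\rangle\langle v|$ is $\|v\|^2|v\rangle\langle v|$, so the root is
$\|v\|^{-1}|v\rangle\langle v|$ when $v\ne0$. Unnormalised vectors are needed because the fidelity
uses $v=\sqrt\sigma\,\psi$. -/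
theorem sqrt_pureState (v : m → ℂ) :
    (CFC.sqrt (pureState v)).trace.re = Real.sqrt (star v ⬝ᵥ v).re := by
  set t := Real.sqrt (star v ⬝ᵥ v).re with ht
  have h0 : 0 ≤ star v ⬝ᵥ v := dotProduct_star_self_nonneg v
  have hre : star v ⬝ᵥ v = ((star v ⬝ᵥ v).re : ℂ) :=
    Complex.ext rfl (by simpa using (Complex.le_def.1 h0).2.symm)
  have htt : ((t : ℂ)) * t = star v ⬝ᵥ v := by
    rw [hre, ← Complex.ofReal_mul, Real.mul_self_sqrt (Complex.le_def.1 h0).1]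
  by_cases hv : v = 0
  · subst hv
    simp [ht, pureState]
  have htne : t ≠ 0 := by
    intro h
    rw [h] at htt
    exact hv (dotProduct_star_self_eq_zero.1 (by simpa using htt.symm))
  have hs : CFC.sqrt (pureState v) = ((t⁻¹ : ℝ) : ℂ) • pureState v := by
    refine CFC.sqrt_unique ?_ ?_
    · have := pureState_mul_mul_pureState v 1
      rw [Matrix.mul_one, Matrix.one_mulVec, ← htt] at this
      rw [Matrix.smul_mul, Matrix.mul_smul, this, smul_smul, smul_smul]
      have : (((t⁻¹ : ℝ) : ℂ)) * ((t⁻¹ : ℝ) : ℂ) * (t * t) = 1 := by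
        have : (t : ℂ) ≠ 0 := by exact_mod_cast htne
        push_cast; field_simp
      rw [this, one_smul]
    · rw [Matrix.nonneg_iff_posSemidef]
      refine (pureState_posSemidef v).smul ?_
      rw [Complex.zero_le_real]
      exact inv_nonneg.2 (Real.sqrt_nonneg _)
  have htr : (pureState v).trace = t * t := by
    rw [pureState, Matrix.trace_vecMulVec, dotProduct_comm, htt]
  rw [hs, Matrix.trace_smul, htr, smul_eq_mul, ← Complex.ofReal_mul, ← Complex.ofReal_mul,
    Complex.ofReal_re]
  field_simp

/-- The fidelity of a pure state with an arbitrary state. -/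
theorem fidelity_pureState (ψ : m → ℂ) {σ : Matrix m m ℂ} (hσ : σ.PosSemidef) :
    fidelity (pureState ψ) σ = Real.sqrt (star ψ ⬝ᵥ σ *ᵥ ψ).re := by
  have hs : (CFC.sqrt σ).IsHermitian := (Matrix.nonneg_iff_posSemidef.1 (CFC.sqrt_nonneg σ)).1
  have hss : CFC.sqrt σ * CFC.sqrt σ = σ :=
    CFC.sqrt_mul_sqrt_self σ (Matrix.nonneg_iff_posSemidef.2 hσ)
  have e : CFC.sqrt σ * pureState ψ * CFC.sqrt σ = pureState (CFC.sqrt σ *ᵥ ψ) := by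
    rw [pureState, pureState, Matrix.mul_vecMulVec, Matrix.vecMulVec_mul, Matrix.star_mulVec, hs.eq]
  rw [fidelity, e, sqrt_pureState, Matrix.star_mulVec, hs.eq, ← Matrix.dotProduct_mulVec,
    Matrix.mulVec_mulVec, hss]

theorem purifiedDist_pureState (ψ : m → ℂ) {σ : Matrix m m ℂ} (hσ : σ.PosSemidef) :
    purifiedDist (pureState ψ) σ = Real.sqrt (1 - (star ψ ⬝ᵥ σ *ᵥ ψ).re) := by
  rw [purifiedDist, fidelity_pureState ψ hσ, Real.sq_sqrt]
  exact hσ.re_dotProduct_nonneg ψ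

end Fidelity

end QRecovery

namespace QRecovery

/-! ### Positive matrices: compactness, pseudo-inverse, supports -/

section PosSemidef

variable {m : Type*} [Fintype m]

theorem isClosed_posSemidef : IsClosed {M : Matrix m m ℂ | M.PosSemidef} := by
  simp only [Matrix.posSemidef_iff_dotProduct_mulVec, Set.ofPred_and, Set.ofPred_forall]
  refine IsClosed.inter ?_ (isClosed_iInter fun x => ?_)
  · exact isClosed_eq (by fun_prop) continuous_id
  · exact isClosed_le continuous_const (by fun_prop)

theorem trace_eq_ofReal {M : Matrix m m ℂ} (hM : M.PosSemidef) : M.trace = (M.trace.re : ℂ) :=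
  Complex.ext rfl (by simpa using (Complex.le_def.1 hM.trace_nonneg).2.symm)

theorem trace_re_nonneg {M : Matrix m m ℂ} (hM : M.PosSemidef) : 0 ≤ M.trace.re :=
  (Complex.le_def.1 hM.trace_nonneg).1

omit [Fintype m] in
theorem posSemidef_real_smul {M : Matrix m m ℂ} (hM : M.PosSemidef) {c : ℝ} (hc : 0 ≤ c) :
    ((c : ℂ) • M).PosSemidef :=
  hM.smul (Complex.zero_le_real.2 hc)

omit [Fintype m] in
theorem isCompact_of_norm_apply_le {S : Set (Matrix m m ℂ)} (hS : IsClosed S) (C : ℝ)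
    (hC : ∀ M ∈ S, ∀ i j, ‖M i j‖ ≤ C) : IsCompact S := by
  have hK : IsCompact (Set.univ.pi fun _ : m => Set.univ.pi fun _ : m =>
      Metric.closedBall (0 : ℂ) C) :=
    isCompact_univ_pi fun _ => isCompact_univ_pi fun _ => isCompact_closedBall 0 C
  exact IsCompact.of_isClosed_subset hK hS fun M hM => Set.mem_univ_pi.2 fun i =>
    Set.mem_univ_pi.2 fun j => mem_closedBall_zero_iff.2 (hC M hM i j)

variable [DecidableEq m]

/-- Cauchy–Schwarz on matrix units gives $|M_{ij}|^2\le M_{ii}M_{jj}$. This supplies the boundedness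
in every compactness argument below. -/
theorem norm_apply_le_trace {M : Matrix m m ℂ} (hM : M.PosSemidef) (i j : m) :
    ‖M i j‖ ≤ M.trace.re := by
  have hd : ∀ k, (M k k).re ≤ M.trace.re := by
    intro k
    rw [Matrix.trace, Complex.re_sum]
    exact Finset.single_le_sum (f := fun k => (M.diag k).re)
      (fun l _ => (Complex.le_def.1 (hM.diag_nonneg (i := l))).1) (Finset.mem_univ k)
  have h := norm_trace_mul_le hM (Matrix.single j j 1) (Matrix.single j i 1)
  simp only [Matrix.conjTranspose_single, star_one, Matrix.single_mul_single_same, mul_one,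
    Matrix.trace_mul_single, MulOpposite.op_one, one_smul] at h
  refine h.trans ?_
  calc _ ≤ Real.sqrt M.trace.re * Real.sqrt M.trace.re :=
        mul_le_mul (Real.sqrt_le_sqrt (hd _)) (Real.sqrt_le_sqrt (hd _)) (Real.sqrt_nonneg _)
          (Real.sqrt_nonneg _)
    _ = M.trace.re := Real.mul_self_sqrt (trace_re_nonneg hM)

theorem exists_le_smul_one {M : Matrix m m ℂ} (hM : M.PosSemidef) :
    ∃ C : ℝ, 0 ≤ C ∧ ((C : ℂ) • (1 : Matrix m m ℂ) - M).PosSemidef := by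
  obtain ⟨C, hC⟩ := M.finite_real_spectrum.bddAbove
  refine ⟨max C 0, le_max_right _ _, ?_⟩
  have h : M ≤ algebraMap ℝ _ (max C 0) :=
    le_algebraMap_of_spectrum_le (fun x hx => (hC hx).trans (le_max_left _ _))
      hM.1.isSelfAdjoint
  rw [Matrix.le_iff, Algebra.algebraMap_eq_smul_one] at h
  rwa [Complex.coe_smul]

/-- The pseudo-inverse of a positive semidefinite matrix. -/
theorem exists_pseudoInverse {ρ : Matrix m m ℂ} (hρ : ρ.PosSemidef) :
    ∃ g : Matrix m m ℂ, g.IsHermitian ∧ ρ * g = g * ρ ∧ ρ * g * ρ = ρ ∧ g * ρ * g = g ∧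
      ∃ C : ℝ, 0 ≤ C ∧ ((C : ℂ) • ρ - ρ * g).PosSemidef := by
  have hsa : IsSelfAdjoint ρ := hρ.1.isSelfAdjoint
  have hfin := ρ.finite_real_spectrum
  have hc : ∀ f : ℝ → ℝ, ContinuousOn f (spectrum ℝ ρ) := fun f => hfin.continuousOn f
  have hid : cfc (fun x : ℝ => x) ρ = ρ := cfc_id' ℝ ρ hsa
  have hmul : ∀ f h : ℝ → ℝ, cfc f ρ * cfc h ρ = cfc (fun x => f x * h x) ρ :=
    fun f h => (cfc_mul f h ρ (hc f) (hc h)).symm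
  -- The convention `0⁻¹ = 0` makes this the pseudo-inverse, and `ρ * g` the projection onto the
  -- support of `ρ`.
  set g := cfc (fun x : ℝ => x⁻¹) ρ with hg
  have hρg : ρ * g = cfc (fun x : ℝ => x * x⁻¹) ρ := by
    conv_lhs => rw [← hid]
    rw [hid, hg]
    conv_lhs => arg 1; rw [← hid]
    exact hmul _ _
  have hgρ : g * ρ = cfc (fun x : ℝ => x⁻¹ * x) ρ := by
    rw [hg]
    conv_lhs => arg 2; rw [← hid]
    exact hmul _ _
  have hcomm : ρ * g = g * ρ := by
    rw [hρg, hgρ]; congr 1; ext x; exact mul_comm _ _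
  refine ⟨g, (cfc_predicate (fun x : ℝ => x⁻¹) ρ : IsSelfAdjoint g), hcomm, ?_, ?_, ?_⟩
  · rw [hρg]
    conv_lhs => arg 2; rw [← hid]
    rw [hmul]
    conv_rhs => rw [← hid]
    congr 1; ext x; exact mul_inv_mul_cancel x
  · rw [hgρ, hg, hmul]
    congr 1; ext x
    by_cases hx : x = 0
    · simp [hx]
    · field_simp
  · obtain ⟨C, hC⟩ := (hfin.image fun x : ℝ => x⁻¹).bddAbove
    refine ⟨max C 0, le_max_right _ _, ?_⟩
    have hle : cfc (fun x : ℝ => x * x⁻¹) ρ ≤ cfc (fun x : ℝ => max C 0 * x) ρ := by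
      refine cfc_mono (fun x hx => ?_) (hc _) (hc _)
      have hx0 : 0 ≤ x := spectrum_nonneg_of_nonneg hρ.nonneg hx
      rw [mul_comm]
      exact mul_le_mul_of_nonneg_right ((hC ⟨x, hx, rfl⟩).trans (le_max_left _ _)) hx0
    rw [cfc_const_mul _ _ _ (hc _), hid, ← hρg, Matrix.le_iff] at hle
    rwa [Complex.coe_smul]

theorem mul_eq_zero_of_conj_eq_zero {M K : Matrix m m ℂ} (hM : M.PosSemidef)
    (h : Kᴴ * M * K = 0) : M * K = 0 := by
  obtain ⟨B, rfl⟩ := exists_eq_conjTranspose_mul_self hM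
  have : (B * K)ᴴ * (B * K) = 0 := by
    rw [Matrix.conjTranspose_mul, ← h]; simp only [Matrix.mul_assoc]
  rw [Matrix.mul_assoc, Matrix.conjTranspose_mul_self_eq_zero.1 this, Matrix.mul_zero]

/-- A positive semidefinite matrix dominated by `ρ` is supported on the support of `ρ`. -/
theorem mul_support_eq_of_le {ρ g M : Matrix m m ℂ} {c : ℝ} (hg : g.IsHermitian)
    (hρ : ρ.IsHermitian)
    (hcomm : ρ * g = g * ρ) (hρgρ : ρ * g * ρ = ρ) (hM : M.PosSemidef)
    (hle : ((c : ℂ) • ρ - M).PosSemidef) : M * (ρ * g) = M := by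
  -- The projection onto the kernel of `ρ`: compressing `M ≤ c ρ` by it leaves a matrix both
  -- nonnegative and nonpositive.
  set K := 1 - ρ * g with hK
  have hKh : K.IsHermitian := by
    refine Matrix.isHermitian_one.sub ?_
    rw [Matrix.IsHermitian, Matrix.conjTranspose_mul, hg.eq, hρ.eq, hcomm]
  have hρK : ρ * K = 0 := by
    rw [hK, Matrix.mul_sub, Matrix.mul_one, hcomm, ← Matrix.mul_assoc, hρgρ, sub_self]
  have h1 : 0 ≤ Kᴴ * M * K := (hM.conjTranspose_mul_mul_same K).nonneg
  have h2 : Kᴴ * M * K ≤ 0 := by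
    have := hle.conjTranspose_mul_mul_same K
    rw [Matrix.mul_sub Kᴴ, Matrix.sub_mul (Kᴴ * _), Matrix.mul_assoc, Matrix.smul_mul, hρK] at this
    rw [Matrix.le_iff]
    simpa using this
  have h3 := mul_eq_zero_of_conj_eq_zero hM (le_antisymm h2 h1)
  rw [hK, Matrix.mul_sub, Matrix.mul_one, sub_eq_zero] at h3
  exact h3.symm

/-- A positive semidefinite matrix supported on the support of `ρ` is dominated by a multiple
of `ρ`. -/
theorem exists_le_smul_of_mul_support_eq {ρ g M : Matrix m m ℂ} {C : ℝ} (hg : g.IsHermitian)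
    (hρ : ρ.IsHermitian)
    (hcomm : ρ * g = g * ρ) (hρgρ : ρ * g * ρ = ρ) (hC0 : 0 ≤ C)
    (hC : ((C : ℂ) • ρ - ρ * g).PosSemidef) (hM : M.PosSemidef) (hsupp : M * (ρ * g) = M) :
    ∃ c : ℝ, 0 ≤ c ∧ ((c : ℂ) • ρ - M).PosSemidef := by
  obtain ⟨T, hT0, hT⟩ := exists_le_smul_one hM
  have hPh : (ρ * g)ᴴ = ρ * g := by
    rw [Matrix.conjTranspose_mul, hg.eq, hρ.eq, hcomm]
  have hPP : (ρ * g) * (ρ * g) = ρ * g := by rw [← Matrix.mul_assoc, hρgρ]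
  have h1 := hT.conjTranspose_mul_mul_same (ρ * g)
  have hPM : ρ * g * M = M := by
    have := congrArg Matrix.conjTranspose hsupp
    rwa [Matrix.conjTranspose_mul, hPh, hM.1.eq] at this
  rw [Matrix.mul_sub, Matrix.sub_mul, hPh, hPM, hsupp, Matrix.mul_smul, Matrix.mul_one,
    Matrix.smul_mul, hPP] at h1
  -- `M ≤ T • (ρ * g) ≤ (T * C) • ρ`.
  refine ⟨T * C, mul_nonneg hT0 hC0, ?_⟩
  have h2 := posSemidef_real_smul hC hT0
  have h3 := h1.add h2
  convert h3 using 1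
  rw [smul_sub, smul_smul, Complex.ofReal_mul]
  abel

end PosSemidef

/-! ### Maxima over decompositions of a state -/

section Decomposition

variable {m : Type*} [Fintype m]

theorem isDecomposition_single {ρ : Matrix m m ℂ} (hρ : IsDensity ρ) :
    IsDecomposition ρ 1 (fun _ => 1) (fun _ => ρ) :=
  ⟨fun _ => one_pos, by simp, fun _ => hρ, by simp⟩

theorem isDecomposition_pair {ρ M : Matrix m m ℂ} (hρ : IsDensity ρ) (hM : M.PosSemidef)
    (hM' : (ρ - M).PosSemidef) {t : ℝ} (ht : M.trace = (t : ℂ)) (ht0 : 0 < t) (ht1 : t < 1) :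
    IsDecomposition ρ 2 ![t, 1 - t]
      ![((t⁻¹ : ℝ) : ℂ) • M, (((1 - t)⁻¹ : ℝ) : ℂ) • (ρ - M)] := by
  have h1 : 0 < 1 - t := sub_pos.2 ht1
  have hc : (t : ℂ) ≠ 0 := by exact_mod_cast ht0.ne'
  have hc1 : ((1 - t : ℝ) : ℂ) ≠ 0 := by exact_mod_cast h1.ne'
  refine ⟨?_, by simp, ?_, ?_⟩
  · intro j; fin_cases j
    · exact ht0
    · exact h1
  · intro j; fin_cases j
    · refine ⟨posSemidef_real_smul hM (inv_nonneg.2 ht0.le), ?_⟩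
      simp [Matrix.trace_smul, ht, hc]
    · refine ⟨posSemidef_real_smul hM' (inv_nonneg.2 h1.le), ?_⟩
      change Matrix.trace ((((1 - t)⁻¹ : ℝ) : ℂ) • (ρ - M)) = 1
      rw [Matrix.trace_smul, Matrix.trace_sub, ht, hρ.2, smul_eq_mul, Complex.ofReal_inv,
        ← Complex.ofReal_one, ← Complex.ofReal_sub, inv_mul_cancel₀ hc1]
      simp
  · rw [Fin.sum_univ_two]
    change ρ = (t : ℂ) • (((t⁻¹ : ℝ) : ℂ) • M) +
      ((1 - t : ℝ) : ℂ) • ((((1 - t)⁻¹ : ℝ) : ℂ) • (ρ - M))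
    rw [smul_smul, smul_smul, Complex.ofReal_inv, Complex.ofReal_inv, mul_inv_cancel₀ hc,
      mul_inv_cancel₀ hc1]
    simp

theorem IsDecomposition.sum_posSemidef {ρ : Matrix m m ℂ} {d : ℕ} {p : Fin d → ℝ}
    {ρs : Fin d → Matrix m m ℂ} (h : IsDecomposition ρ d p ρs) (s : Finset (Fin d)) :
    (∑ j ∈ s, (p j : ℂ) • ρs j).PosSemidef ∧ (ρ - ∑ j ∈ s, (p j : ℂ) • ρs j).PosSemidef := by
  have hp : ∀ s : Finset (Fin d), (∑ j ∈ s, (p j : ℂ) • ρs j).PosSemidef := fun s =>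
    Matrix.posSemidef_sum s fun j _ => posSemidef_real_smul (h.2.2.1 j).1 (h.1 j).le
  refine ⟨hp s, ?_⟩
  rw [h.2.2.2, ← Finset.sum_compl_add_sum s, add_sub_cancel_right]
  exact hp sᶜ

variable [DecidableEq m]

/-- The matrices between `0` and `ρ`. -/
theorem isCompact_between (ρ : Matrix m m ℂ) :
    IsCompact {M : Matrix m m ℂ | M.PosSemidef ∧ (ρ - M).PosSemidef} := by
  refine isCompact_of_norm_apply_le (isClosed_posSemidef.inter
    (isClosed_posSemidef.preimage (f := fun M => ρ - M) (by fun_prop))) ρ.trace.re ?_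
  rintro M ⟨hM, hM'⟩ i j
  refine (norm_apply_le_trace hM i j).trans ?_
  have := trace_re_nonneg hM'
  rw [Matrix.trace_sub, Complex.sub_re] at this
  linarith

omit [Fintype m] [DecidableEq m] in
theorem real_smul_map (G : Matrix m m ℂ →ₗ[ℝ] ℝ) (c : ℝ) (M : Matrix m m ℂ) :
    G ((c : ℂ) • M) = c * G M := by
  rw [Complex.coe_smul, map_smul, smul_eq_mul]

/-- The maximal weighted mean and the maximal weighted term of a centred linear functional over all
decompositions of `ρ` come from the same maximization over the matrices between `0` and `ρ`. -/
theorem exists_isGreatest_decomposition (G : Matrix m m ℂ →ₗ[ℝ] ℝ) {ρ : Matrix m m ℂ}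
    (hρ : IsDensity ρ) (hG : G ρ = 0) :
    ∃ M : Matrix m m ℂ, M.PosSemidef ∧ (ρ - M).PosSemidef ∧
      IsGreatest {x | ∃ (d : ℕ) (p : Fin d → ℝ) (ρs : Fin d → Matrix m m ℂ),
        IsDecomposition ρ d p ρs ∧ x = ∑ j, p j * |G (ρs j)|} (2 * G M) ∧
      IsGreatest {x | ∃ (d : ℕ) (p : Fin d → ℝ) (ρs : Fin d → Matrix m m ℂ),
        IsDecomposition ρ d p ρs ∧ ∃ j, x = p j * |G (ρs j)|} (G M) := by
  have hcont : Continuous G := G.continuous_of_finiteDimensional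
  obtain ⟨M, ⟨hM, hM'⟩, hmax⟩ := (isCompact_between ρ).exists_isMaxOn
    ⟨0, Matrix.PosSemidef.zero, by simpa using hρ.1⟩ hcont.continuousOn
  have hmax : ∀ N : Matrix m m ℂ, N.PosSemidef → (ρ - N).PosSemidef → G N ≤ G M :=
    fun N h1 h2 => hmax ⟨h1, h2⟩
  have h0 : 0 ≤ G M := by
    simpa using hmax 0 Matrix.PosSemidef.zero (by simpa using hρ.1)
  have hatt : ∃ (d : ℕ) (p : Fin d → ℝ) (ρs : Fin d → Matrix m m ℂ), IsDecomposition ρ d p ρs ∧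
      2 * G M = ∑ j, p j * |G (ρs j)| ∧ ∃ j, G M = p j * |G (ρs j)| := by
    -- If the maximum is zero the trivial decomposition attains it. Otherwise `M` is neither `0` nor
    -- `ρ`, so its trace lies strictly between 0 and 1, and normalising `M` and `ρ - M` gives two
    -- members, each contributing `G M`.
    rcases h0.eq_or_lt with h | h
    · exact ⟨1, _, _, isDecomposition_single hρ, by simp [← h, hG], 0, by simp [← h, hG]⟩
    · have htr := trace_eq_ofReal hM
      have ht0 : 0 < M.trace.re := by
        refine lt_of_le_of_ne (trace_re_nonneg hM) fun h1 => ?_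
        rw [← h1, Complex.ofReal_zero, hM.trace_eq_zero_iff] at htr
        rw [htr, map_zero] at h
        exact lt_irrefl _ h
      have ht1 : M.trace.re < 1 := by
        have h1 := trace_re_nonneg hM'
        have h2 := trace_eq_ofReal hM'
        rw [Matrix.trace_sub, hρ.2, Complex.sub_re, Complex.one_re] at h1
        refine lt_of_le_of_ne (by linarith) fun h3 => ?_
        rw [Matrix.trace_sub, hρ.2, Complex.sub_re, Complex.one_re, h3, sub_self,
          Complex.ofReal_zero, ← hρ.2, ← Matrix.trace_sub, hM'.trace_eq_zero_iff,
          sub_eq_zero] at h2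
        rw [← h2, hG] at h
        exact lt_irrefl _ h
      have h1 : 0 < 1 - M.trace.re := sub_pos.2 ht1
      have e0 : M.trace.re * |G (((M.trace.re⁻¹ : ℝ) : ℂ) • M)| = G M := by
        rw [real_smul_map, abs_mul, abs_of_pos (inv_pos.2 ht0), abs_of_pos h, ← mul_assoc,
          mul_inv_cancel₀ ht0.ne', one_mul]
      have e1 : (1 - M.trace.re) * |G ((((1 - M.trace.re)⁻¹ : ℝ) : ℂ) • (ρ - M))| = G M := by
        rw [real_smul_map, abs_mul, abs_of_pos (inv_pos.2 h1), ← mul_assoc,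
          mul_inv_cancel₀ h1.ne', one_mul, map_sub, hG, zero_sub, abs_neg, abs_of_pos h]
      refine ⟨2, _, _, isDecomposition_pair hρ hM hM' htr ht0 ht1, ?_, 0, e0.symm⟩
      rw [Fin.sum_univ_two, two_mul]
      exact (congrArg₂ (· + ·) e0 e1).symm
  obtain ⟨d, p, ρs, hdec, hs, j, hj⟩ := hatt
  refine ⟨M, hM, hM', ⟨⟨d, p, ρs, hdec, hs⟩, ?_⟩, ⟨⟨d, p, ρs, hdec, j, hj⟩, ?_⟩⟩
  · rintro x ⟨d, p, ρs, hdec, rfl⟩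
    -- The members with `G > 0` sum to a competitor for `M`; as all weighted values sum to zero, the
    -- absolute values sum to twice its value.
    have hs := hdec.sum_posSemidef (Finset.univ.filter fun j => 0 < G (ρs j))
    have hle := hmax _ hs.1 hs.2
    have hz : ∑ j, p j * G (ρs j) = 0 := by
      rw [← hG, hdec.2.2.2, map_sum]
      exact Finset.sum_congr rfl fun j _ => (real_smul_map G _ _).symm
    rw [map_sum, Finset.sum_filter] at hle
    calc ∑ j, p j * |G (ρs j)|
        = ∑ j, (2 * (if 0 < G (ρs j) then G ((p j : ℂ) • ρs j) else 0) - p j * G (ρs j)) := by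
          refine Finset.sum_congr rfl fun j _ => ?_
          split_ifs with h
          · rw [abs_of_pos h, real_smul_map]; ring
          · rw [abs_of_nonpos (not_lt.1 h)]; ring
      _ ≤ 2 * G M := by
          rw [Finset.sum_sub_distrib, hz, ← Finset.mul_sum]; linarith
  · rintro x ⟨d, p, ρs, hdec, j, rfl⟩
    have hs := hdec.sum_posSemidef {j}
    rw [Finset.sum_singleton] at hs
    have h1 := hmax _ hs.1 hs.2
    -- The complementary part `ρ - p j • ρs j` is also a competitor and bounds `-G`.
    have h2 := hmax _ hs.2 (by simpa using hs.1)
    rw [map_sub, hG, zero_sub] at h2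
    rw [real_smul_map] at h1 h2
    rcases abs_cases (G (ρs j)) with ⟨h, _⟩ | ⟨h, _⟩ <;> rw [h] <;> linarith

/-- The maximum of a linear functional over the members of the decompositions of `ρ` exists. -/
theorem exists_isGreatest_member (G : Matrix m m ℂ →ₗ[ℝ] ℝ) {ρ : Matrix m m ℂ}
    (hρ : IsDensity ρ) :
    ∃ x, IsGreatest {x | ∃ (d : ℕ) (p : Fin d → ℝ) (ρs : Fin d → Matrix m m ℂ),
        IsDecomposition ρ d p ρs ∧ ∃ j, x = |G (ρs j)|} x := by
  obtain ⟨g, hg, hcomm, hρgρ, -, C, hC0, hC⟩ := exists_pseudoInverse hρ.1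
  have hcont : Continuous G := G.continuous_of_finiteDimensional
  -- The weights have no positive lower bound, so compactness comes from another description:
  -- members of decompositions are exactly the density matrices supported on the support of `ρ`.
  have hK : IsCompact {M : Matrix m m ℂ | M.PosSemidef ∧ M.trace = 1 ∧ M * (ρ * g) = M} := by
    refine isCompact_of_norm_apply_le (isClosed_posSemidef.inter ((isClosed_eq
      (f := fun M : Matrix m m ℂ => M.trace) (by fun_prop) continuous_const).inter
      (isClosed_eq (f := fun M : Matrix m m ℂ => M * (ρ * g)) (by fun_prop) continuous_id))) 1 ?_
    rintro M ⟨hM, hM', -⟩ i j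
    simpa [hM'] using norm_apply_le_trace hM i j
  obtain ⟨M, ⟨hM, htr, hsupp⟩, hmax⟩ := hK.exists_isMaxOn
    ⟨ρ, hρ.1, hρ.2, by rw [hcomm, ← Matrix.mul_assoc, hρgρ]⟩ (f := fun M => |G M|)
    hcont.abs.continuousOn
  refine ⟨|G M|, ?_, ?_⟩
  · obtain ⟨c, hc0, hc⟩ := exists_le_smul_of_mul_support_eq hg hρ.1.1 hcomm hρgρ hC0 hC hM hsupp
    -- The shift by 2 makes the weight `(c + 2)⁻¹` strictly less than 1, as a two-member
    -- decomposition requires.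
    have hc2 : (0 : ℝ) < c + 2 := by linarith
    have hcne : ((c + 2 : ℝ) : ℂ) ≠ 0 := by exact_mod_cast hc2.ne'
    have hle : (ρ - (((c + 2)⁻¹ : ℝ) : ℂ) • M).PosSemidef := by
      have h1 := hc.add (posSemidef_real_smul hρ.1 zero_le_two)
      have h2 := posSemidef_real_smul h1 (inv_nonneg.2 hc2.le)
      convert h2 using 1
      have : (c : ℂ) • ρ - M + ((2 : ℝ) : ℂ) • ρ = ((c + 2 : ℝ) : ℂ) • ρ - M := by
        rw [Complex.ofReal_add, add_smul]; abel
      rw [this, smul_sub, smul_smul, Complex.ofReal_inv, inv_mul_cancel₀ hcne, one_smul]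
    have hdec := isDecomposition_pair hρ (posSemidef_real_smul hM (inv_nonneg.2 hc2.le)) hle
      (t := (c + 2)⁻¹) (by rw [Matrix.trace_smul, htr, smul_eq_mul, mul_one]) (inv_pos.2 hc2)
      (inv_lt_one_of_one_lt₀ (by linarith))
    refine ⟨2, _, _, hdec, 0, ?_⟩
    change |G M| = |G ((((c + 2)⁻¹⁻¹ : ℝ) : ℂ) • ((((c + 2)⁻¹ : ℝ) : ℂ) • M))|
    rw [smul_smul, inv_inv, Complex.ofReal_inv, mul_inv_cancel₀ hcne, one_smul]
  · rintro x ⟨d, p, ρs, hdec, j, rfl⟩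
    refine hmax ⟨(hdec.2.2.1 j).1, (hdec.2.2.1 j).2, ?_⟩
    have hs := hdec.sum_posSemidef {j}
    rw [Finset.sum_singleton] at hs
    have hpj := hdec.1 j
    have hpne : (p j : ℂ) ≠ 0 := by exact_mod_cast hpj.ne'
    refine mul_support_eq_of_le (c := (p j)⁻¹) hg hρ.1.1 hcomm hρgρ (hdec.2.2.1 j).1 ?_
    have := posSemidef_real_smul hs.2 (inv_nonneg.2 hpj.le)
    rwa [smul_sub, smul_smul, Complex.ofReal_inv, inv_mul_cancel₀ hpne, one_smul,
      ← Complex.ofReal_inv] at this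

end Decomposition

end QRecovery

namespace QRecovery

/-! ### Partial traces, Choi matrices and optimal recovery -/

section PartialTrace

variable {m n : Type*} [Fintype m] [Fintype n]

omit [Fintype n] in
theorem traceFst_posSemidef {M : Matrix (m × n) (m × n) ℂ} (hM : M.PosSemidef) :
    (traceFst M).PosSemidef := by
  have : traceFst M = ∑ x, M.submatrix (fun i => (x, i)) (fun i => (x, i)) := by
    ext i j; simp [traceFst, Matrix.sum_apply]
  rw [this]
  exact Matrix.posSemidef_sum _ fun x _ => hM.submatrix _

omit [Fintype m] in
theorem traceSnd_posSemidef {M : Matrix (m × n) (m × n) ℂ} (hM : M.PosSemidef) :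
    (traceSnd M).PosSemidef := by
  have : traceSnd M = ∑ x, M.submatrix (fun i => (i, x)) (fun i => (i, x)) := by
    ext i j; simp [traceSnd, Matrix.sum_apply]
  rw [this]
  exact Matrix.posSemidef_sum _ fun x _ => hM.submatrix _

end PartialTrace

section Channels

variable {m n : Type*} [Fintype m] [Fintype n] [DecidableEq m]

omit [DecidableEq m] in
-- Complete positivity is tested on references `Fin d` only; relabelling the basis transfers it to
-- any finite reference.
theorem IsCPTP.tensorId_posSemidef {k : Type*} [Fintype k]
    {Φ : Matrix m m ℂ →ₗ[ℂ] Matrix n n ℂ} (hΦ : IsCPTP Φ) {M : Matrix (m × k) (m × k) ℂ}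
    (hM : M.PosSemidef) : (tensorId Φ M).PosSemidef := by
  have e := Fintype.equivFin k
  have h := hΦ.1 _ _ (hM.submatrix (Prod.map id e.symm))
  have h2 := h.submatrix (Prod.map (id : n → n) e)
  convert h2 using 1
  ext x y
  simp [tensorId]

/-- The linear map with a given Choi matrix. -/
def choiMap (T : Matrix (m × n) (m × n) ℂ) : Matrix m m ℂ →ₗ[ℂ] Matrix n n ℂ where
  toFun M := Matrix.of fun i j => ∑ a, ∑ b, M a b * T (a, i) (b, j)
  map_add' M N := by
    ext i j
    simp [add_mul, Finset.sum_add_distrib]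
  map_smul' c M := by
    ext i j
    simp [Finset.mul_sum, mul_assoc]

omit [Fintype n] [DecidableEq m] in
theorem choiMap_apply (T : Matrix (m × n) (m × n) ℂ) (M : Matrix m m ℂ) (i j : n) :
    choiMap T M i j = ∑ a, ∑ b, M a b * T (a, i) (b, j) := rfl

omit [Fintype n] in
theorem choiMap_single (T : Matrix (m × n) (m × n) ℂ) (a b : m) (i j : n) :
    choiMap T (Matrix.single a b 1) i j = T (a, i) (b, j) := by
  rw [choiMap_apply, Finset.sum_eq_single a, Finset.sum_eq_single b]
  · simp
  · intro c _ hc; simp [Matrix.single_apply_of_ne, hc.symm]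
  · simp
  · intro c _ hc; simp [Matrix.single_apply_of_ne, hc.symm]
  · simp

omit [Fintype n] in
theorem exists_choiMap_eq (Φ : Matrix m m ℂ →ₗ[ℂ] Matrix n n ℂ) :
    ∃ T, choiMap T = Φ := by
  refine ⟨Matrix.of fun x y => Φ (Matrix.single x.1 y.1 1) x.2 y.2, ?_⟩
  refine Matrix.ext_linearMap ℂ fun a b => LinearMap.ext_ring ?_
  ext i j
  simp [choiMap_single]

omit [Fintype n] [DecidableEq m] in
theorem continuous_choiMap (M : Matrix m m ℂ) (i j : n) :
    Continuous fun T : Matrix (m × n) (m × n) ℂ => choiMap T M i j := by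
  simp only [choiMap_apply]
  fun_prop

omit [Fintype n] [DecidableEq m] in
theorem continuous_tensorId_choiMap {k : Type*} (M : Matrix (m × k) (m × k) ℂ) :
    Continuous fun T : Matrix (m × n) (m × n) ℂ => tensorId (choiMap T) M :=
  continuous_matrix fun _ _ => continuous_choiMap _ _ _

omit [DecidableEq m] in
theorem isClosed_isCPTP_choiMap :
    IsClosed {T : Matrix (m × n) (m × n) ℂ | IsCPTP (choiMap T)} := by
  simp only [IsCPTP, Set.ofPred_and, Set.ofPred_forall]
  refine IsClosed.inter ?_ ?_
  · refine isClosed_iInter fun d => isClosed_iInter fun M => isClosed_iInter fun hM => ?_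
    exact isClosed_posSemidef.preimage (continuous_tensorId_choiMap M)
  · refine isClosed_iInter fun M => isClosed_eq ?_ continuous_const
    exact continuous_finsetSum _ fun i _ => continuous_choiMap _ _ _

/-- Up to a swap of factors, the Choi matrix is the image of the unnormalised maximally entangled
projector. -/
theorem IsCPTP.choi_posSemidef {T : Matrix (m × n) (m × n) ℂ} (hT : IsCPTP (choiMap T)) :
    T.PosSemidef := by
  have h := hT.tensorId_posSemidef
    (pureState_posSemidef fun x : m × m => if x.1 = x.2 then (1 : ℂ) else 0)
  convert h.submatrix (Prod.swap : m × n → n × m) using 1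
  ext ⟨a, i⟩ ⟨b, j⟩
  rw [Matrix.submatrix_apply, ← choiMap_single T a b i j]
  simp only [tensorId, Matrix.of_apply, Prod.fst_swap, Prod.snd_swap]
  refine congrArg (fun K => choiMap T K i j) ?_
  ext c d
  simp only [pureState, Matrix.of_apply, Matrix.vecMulVec_apply, Pi.star_apply,
    Matrix.single_apply]
  by_cases h1 : a = c <;> by_cases h2 : b = d <;> simp [h1, h2, eq_comm]

theorem isCompact_isCPTP_choiMap [DecidableEq n] :
    IsCompact {T : Matrix (m × n) (m × n) ℂ | IsCPTP (choiMap T)} := by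
  refine isCompact_of_norm_apply_le isClosed_isCPTP_choiMap (Fintype.card m) fun T hT x y => ?_
  refine (norm_apply_le_trace (IsCPTP.choi_posSemidef hT) x y).trans (le_of_eq ?_)
  have : T.trace = Fintype.card m := by
    rw [Matrix.trace, Fintype.sum_prod_type]
    have : ∀ a : m, ∑ i, T.diag (a, i) = 1 := by
      intro a
      have := hT.2 (Matrix.single a a 1)
      rw [Matrix.trace_single_eq_same] at this
      rw [← this]
      exact Finset.sum_congr rfl fun i _ => (choiMap_single T a a i i).symm
    simp only [this, Finset.sum_const, Finset.card_univ, nsmul_eq_mul, mul_one]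
  rw [this, Complex.natCast_re]

/-- The channel discarding its input and preparing a fixed basis state; its Choi matrix is a
Kronecker product. -/
theorem exists_isCPTP [DecidableEq n] [Nonempty n] :
    ∃ T : Matrix (m × n) (m × n) ℂ, IsCPTP (choiMap T) := by
  obtain ⟨i₀⟩ := ‹Nonempty n›
  have hval : ∀ M : Matrix m m ℂ, choiMap ((1 : Matrix m m ℂ) ⊗ₖ Matrix.single i₀ i₀ (1 : ℂ)) M =
      M.trace • Matrix.single i₀ i₀ 1 := by
    intro M
    ext i j
    simp only [choiMap_apply, Matrix.kronecker_apply, Matrix.one_apply, Matrix.smul_apply,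
      smul_eq_mul, Matrix.trace, Matrix.diag_apply, Finset.sum_mul]
    refine Finset.sum_congr rfl fun a _ => ?_
    rw [Finset.sum_eq_single a]
    · simp
    · intro b _ hb; simp [hb.symm]
    · simp
  refine ⟨(1 : Matrix m m ℂ) ⊗ₖ Matrix.single i₀ i₀ 1, fun d M hM => ?_, fun M => ?_⟩
  · have h1 : (Matrix.single i₀ i₀ (1 : ℂ)).PosSemidef := by
      have := Matrix.posSemidef_conjTranspose_mul_self (Matrix.single i₀ i₀ (1 : ℂ))
      simpa using this
    have h2 : tensorId (choiMap ((1 : Matrix m m ℂ) ⊗ₖ Matrix.single i₀ i₀ (1 : ℂ))) M =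
        Matrix.single i₀ i₀ (1 : ℂ) ⊗ₖ traceFst M := by
      refine Matrix.ext fun x y => ?_
      change choiMap ((1 : Matrix m m ℂ) ⊗ₖ Matrix.single i₀ i₀ (1 : ℂ))
        (Matrix.of fun a b => M (a, x.2) (b, y.2)) x.1 y.1 = _
      rw [hval, Matrix.smul_apply, Matrix.kroneckerMap_apply, smul_eq_mul, mul_comm]
      rfl
    rw [h2]
    exact h1.kronecker (traceFst_posSemidef hM)
  · rw [hval, Matrix.trace_smul, Matrix.trace_single_eq_same, smul_eq_mul, mul_one]

/-- An optimal recovery channel exists. -/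
theorem exists_isLeast_purifiedDist [DecidableEq n] {k : Type*} [Fintype k] [DecidableEq k]
    {ψ : n × k → ℂ} (hψ : IsUnitVector ψ) {M : Matrix (m × k) (m × k) ℂ} (hM : M.PosSemidef) :
    ∃ x, IsLeast {x | ∃ R : Matrix m m ℂ →ₗ[ℂ] Matrix n n ℂ,
      IsCPTP R ∧ x = purifiedDist (pureState ψ) (tensorId R M)} x := by
  have : Nonempty n := by
    by_contra h
    rw [not_nonempty_iff] at h
    simp [IsUnitVector, dotProduct] at hψ
  have hcont : Continuous fun T : Matrix (m × n) (m × n) ℂ =>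
      Real.sqrt (1 - (star ψ ⬝ᵥ tensorId (choiMap T) M *ᵥ ψ).re) := by
    have := continuous_tensorId_choiMap (n := n) M
    fun_prop
  obtain ⟨T, hT, hmin⟩ := isCompact_isCPTP_choiMap.exists_isMinOn exists_isCPTP hcont.continuousOn
  refine ⟨_, ⟨choiMap T, hT, rfl⟩, ?_⟩
  rintro x ⟨R, hR, rfl⟩
  obtain ⟨S, rfl⟩ := exists_choiMap_eq R
  rw [purifiedDist_pureState ψ (IsCPTP.tensorId_posSemidef hT hM),
    purifiedDist_pureState ψ (IsCPTP.tensorId_posSemidef hR hM)]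
  exact hmin hR

end Channels

end QRecovery

namespace QRecovery

/-! ### Quantum Fisher information of pure states -/

section Fisher

variable {m : Type*} [Fintype m] [DecidableEq m]

open scoped Matrix.Norms.Operator in
theorem tendsto_exp_slope (X : Matrix m m ℂ) :
    Tendsto (fun ε : ℝ => ((ε : ℂ))⁻¹ • (NormedSpace.exp ((-(Complex.I * ε)) • X) - 1))
      (𝓝[≠] 0) (𝓝 ((-Complex.I) • X)) := by
  have h := hasDerivAt_exp_smul_const (𝕂 := ℝ) ((-Complex.I) • X) 0
  rw [hasDerivAt_iff_tendsto_slope] at h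
  simp only [zero_smul, NormedSpace.exp_zero, one_mul] at h
  refine h.congr fun ε => ?_
  have e : ε • ((-Complex.I) • X) = (-(Complex.I * ε)) • X := by
    rw [← Complex.coe_smul, smul_smul]; ring_nf
  rw [slope_def_module, sub_zero, zero_smul, NormedSpace.exp_zero, e, ← Complex.coe_smul,
    Complex.ofReal_inv]
  rfl

/-- The quadratic form which measures the component orthogonal to `χ`. -/
theorem star_dotProduct_one_sub_pureState (χ v : m → ℂ) :
    star v ⬝ᵥ (1 - pureState χ) *ᵥ v = star v ⬝ᵥ v - star v ⬝ᵥ pureState χ *ᵥ v := by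
  rw [Matrix.sub_mulVec, Matrix.one_mulVec, dotProduct_sub]

variable {χ : m → ℂ}

omit [DecidableEq m] in
theorem pureState_mulVec (hχ : IsUnitVector χ) : pureState χ *ᵥ χ = χ := by
  rw [pureState, Matrix.vecMulVec_mulVec, hχ]; simp

theorem pureState_mul_self (hχ : IsUnitVector χ) : pureState χ * pureState χ = pureState χ := by
  have := pureState_mul_mul_pureState χ 1
  rwa [Matrix.mul_one, Matrix.one_mulVec, hχ, one_smul] at this

theorem one_sub_pureState_posSemidef (hχ : IsUnitVector χ) : (1 - pureState χ).PosSemidef := by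
  have hh : (1 - pureState χ).IsHermitian :=
    Matrix.isHermitian_one.sub (pureState_posSemidef χ).1
  have : 1 - pureState χ = (1 - pureState χ)ᴴ * (1 - pureState χ) := by
    rw [hh.eq, Matrix.mul_sub, Matrix.sub_mul 1 _ (pureState χ), pureState_mul_self hχ]; simp
  rw [this]
  exact Matrix.posSemidef_conjTranspose_mul_self _

/-- The infidelity is the squared component of $e^{-i\epsilon X}\chi$ orthogonal to $\chi$. As
$1-|\chi\rangle\langle\chi|$ kills $\chi$, that vector may be replaced by $e^{-i\epsilon
X}\chi-\chi$, which turns the quotient into a continuous function of a difference quotient. -/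
theorem fisherQuotient_pureState (hχ : IsUnitVector χ) {X : Matrix m m ℂ} (hX : X.IsHermitian)
    (ε : ℝ) :
    fisherQuotient (pureState χ) X ε =
      (star ((((ε : ℂ))⁻¹ • (NormedSpace.exp ((-(Complex.I * ε)) • X) - 1)) *ᵥ χ) ⬝ᵥ
        (1 - pureState χ) *ᵥ
          ((((ε : ℂ))⁻¹ • (NormedSpace.exp ((-(Complex.I * ε)) • X) - 1)) *ᵥ χ)).re := by
  set E := NormedSpace.exp ((-(Complex.I * ε)) • X) with hE
  have hE' : NormedSpace.exp ((Complex.I * ε) • X) = Eᴴ := by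
    rw [hE, ← Matrix.exp_conjTranspose, Matrix.conjTranspose_smul, hX.eq]
    simp
  have hEE : Eᴴ * E = 1 := by
    rw [← hE', hE, ← Matrix.exp_add_of_commute]
    · simp
    · exact (Commute.refl X).smul_left _ |>.smul_right _
  have hst : E * pureState χ * Eᴴ = pureState (E *ᵥ χ) := by
    rw [pureState, pureState, Matrix.mul_vecMulVec, Matrix.vecMulVec_mul, Matrix.star_mulVec]
  have hu : star (E *ᵥ χ) ⬝ᵥ (E *ᵥ χ) = 1 := by
    rw [Matrix.star_mulVec, ← Matrix.dotProduct_mulVec, Matrix.mulVec_mulVec, hEE,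
      Matrix.one_mulVec, hχ]
  have hpos := one_sub_pureState_posSemidef hχ
  have hker : (1 - pureState χ) *ᵥ χ = 0 := by
    rw [Matrix.sub_mulVec, Matrix.one_mulVec, pureState_mulVec hχ, sub_self]
  have hker' : star χ ᵥ* (1 - pureState χ) = 0 := by
    have := congrArg star hker
    rwa [Matrix.star_mulVec, hpos.1.eq, star_zero] at this
  have hval : (1 - (star (E *ᵥ χ) ⬝ᵥ pureState χ *ᵥ (E *ᵥ χ)).re) =
      (star (E *ᵥ χ - χ) ⬝ᵥ (1 - pureState χ) *ᵥ (E *ᵥ χ - χ)).re := by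
    rw [Matrix.mulVec_sub, hker, sub_zero, star_sub, sub_dotProduct,
      Matrix.dotProduct_mulVec (star χ), hker', zero_dotProduct, sub_zero,
      star_dotProduct_one_sub_pureState, hu]
    simp
  rw [fisherQuotient, hE', hst, purifiedDist_pureState _ (pureState_posSemidef χ), hval,
    Real.sq_sqrt (show 0 ≤ (star (E *ᵥ χ - χ) ⬝ᵥ (1 - pureState χ) *ᵥ (E *ᵥ χ - χ)).re from
      hpos.re_dotProduct_nonneg _), Matrix.smul_mulVec, Matrix.sub_mulVec E,
    Matrix.one_mulVec, Matrix.mulVec_smul, star_smul, smul_dotProduct, dotProduct_smul]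
  simp only [smul_eq_mul, ← mul_assoc]
  have : star ((ε : ℂ)⁻¹) * (ε : ℂ)⁻¹ = (((ε ^ 2)⁻¹ : ℝ) : ℂ) := by
    simp; ring
  rw [this, Complex.re_ofReal_mul, div_eq_inv_mul]

theorem tendsto_fisherQuotient_pureState (hχ : IsUnitVector χ) {X : Matrix m m ℂ}
    (hX : X.IsHermitian) :
    Tendsto (fisherQuotient (pureState χ) X) (𝓝[≠] 0)
      (𝓝 ((star χ ⬝ᵥ (X * X) *ᵥ χ).re - (star χ ⬝ᵥ X *ᵥ χ).re ^ 2)) := by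
  have hcont : Continuous fun M : Matrix m m ℂ =>
      (star (M *ᵥ χ) ⬝ᵥ (1 - pureState χ) *ᵥ (M *ᵥ χ)).re := by
    fun_prop
  have h := (hcont.tendsto _).comp (tendsto_exp_slope X)
  have him : (star χ ⬝ᵥ X *ᵥ χ).im = 0 := hX.im_star_dotProduct_mulVec_self χ
  convert h using 2
  · ext ε
    exact fisherQuotient_pureState hχ hX ε
  · rw [star_dotProduct_one_sub_pureState, Matrix.smul_mulVec, star_smul, Matrix.mulVec_smul]
    simp only [smul_dotProduct, dotProduct_smul, smul_smul]
    have : -Complex.I * star (-Complex.I) = 1 := by simp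
    have e1 : star (X *ᵥ χ) ⬝ᵥ X *ᵥ χ = star χ ⬝ᵥ (X * X) *ᵥ χ := by
      rw [Matrix.star_mulVec, hX.eq, ← Matrix.dotProduct_mulVec, Matrix.mulVec_mulVec]
    have e2 : star (X *ᵥ χ) ⬝ᵥ pureState χ *ᵥ X *ᵥ χ =
        (star χ ⬝ᵥ X *ᵥ χ) * (star χ ⬝ᵥ X *ᵥ χ) := by
      rw [pureState, Matrix.vecMulVec_mulVec, Matrix.star_mulVec, hX.eq,
        ← Matrix.dotProduct_mulVec]
      simp [Matrix.mulVec_smul, dotProduct_smul]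
    rw [this, one_smul, one_smul, e1, e2, Complex.sub_re, Complex.mul_re, him]
    ring

theorem fisherInfo_pureState (hχ : IsUnitVector χ) {X : Matrix m m ℂ} (hX : X.IsHermitian) :
    fisherInfo (pureState χ) X =
      4 * ((star χ ⬝ᵥ (X * X) *ᵥ χ).re - (star χ ⬝ᵥ X *ᵥ χ).re ^ 2) := by
  rw [fisherInfo, (tendsto_fisherQuotient_pureState hχ hX).limUnder_eq]

end Fisher

end QRecovery

namespace QRecovery

/-! ### Partial trace identities -/

section PartialTraceIdentities

variable {m n : Type*} [Fintype m] [Fintype n]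

theorem trace_traceSnd (M : Matrix (m × n) (m × n) ℂ) : (traceSnd M).trace = M.trace := by
  simp [traceSnd, Matrix.trace, Fintype.sum_prod_type]

theorem trace_traceFst (M : Matrix (m × n) (m × n) ℂ) : (traceFst M).trace = M.trace := by
  simp only [traceFst, Matrix.trace, Matrix.diag_apply, Matrix.of_apply, Fintype.sum_prod_type]
  exact Finset.sum_comm

theorem trace_mul_kronecker_one [DecidableEq n] (M : Matrix (m × n) (m × n) ℂ)
    (X : Matrix m m ℂ) : (M * (X ⊗ₖ (1 : Matrix n n ℂ))).trace = (traceSnd M * X).trace := by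
  simp only [Matrix.trace, Matrix.diag_apply, Matrix.mul_apply, Matrix.kronecker_apply, traceSnd,
    Matrix.of_apply, Fintype.sum_prod_type, Matrix.one_apply, mul_ite, mul_one, mul_zero,
    Finset.sum_ite_eq', Finset.mem_univ, if_true, Finset.sum_mul]
  exact Finset.sum_congr rfl fun i _ => Finset.sum_comm

theorem trace_mul_one_kronecker [DecidableEq m] (M : Matrix (m × n) (m × n) ℂ)
    (X : Matrix n n ℂ) : (M * ((1 : Matrix m m ℂ) ⊗ₖ X)).trace = (traceFst M * X).trace := by
  simp only [Matrix.trace, Matrix.diag_apply, Matrix.mul_apply, Matrix.kronecker_apply, traceFst,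
    Matrix.of_apply, Fintype.sum_prod_type, Matrix.one_apply, ite_mul, one_mul, zero_mul, mul_ite,
    mul_zero, Finset.sum_mul]
  rw [Finset.sum_comm]
  refine Finset.sum_congr rfl fun i _ => ?_
  rw [Finset.sum_comm' (t' := Finset.univ) (s' := fun _ => Finset.univ) (by simp)]
  conv_rhs => rw [Finset.sum_comm]
  refine Finset.sum_congr rfl fun a _ => ?_
  rw [Finset.sum_comm]
  simp

end PartialTraceIdentities

/-! ### The conservation law and the deviation functional -/

section Evolution

variable {A B A' B' : Type*} [Fintype A] [Fintype B] [Fintype A'] [Fintype B']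

omit [Fintype A'] [Fintype B'] in
theorem evolve_add (U : Matrix (A' × B') (A × B) ℂ) (M N : Matrix A A ℂ) (σ : Matrix B B ℂ) :
    evolve U (M + N) σ = evolve U M σ + evolve U N σ := by
  rw [evolve, Matrix.add_kronecker, Matrix.mul_add, Matrix.add_mul]; rfl

omit [Fintype A'] [Fintype B'] in
theorem evolve_smul (U : Matrix (A' × B') (A × B) ℂ) (c : ℂ) (M : Matrix A A ℂ)
    (σ : Matrix B B ℂ) : evolve U (c • M) σ = c • evolve U M σ := by
  rw [evolve, Matrix.smul_kronecker, Matrix.mul_smul, Matrix.smul_mul]; rfl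

/-- The map `M ↦ Tr_{A'} (U (M ⊗ σ) U†)` to the environment `B'`. -/
def environmentMap (U : Matrix (A' × B') (A × B) ℂ) (σ : Matrix B B ℂ) :
    Matrix A A ℂ →ₗ[ℂ] Matrix B' B' ℂ where
  toFun M := traceFst (evolve U M σ)
  map_add' M N := by
    rw [evolve_add]; ext i j; simp [traceFst, Finset.sum_add_distrib]
  map_smul' c M := by
    rw [evolve_smul]; ext i j; simp [traceFst, Finset.mul_sum]

omit [Fintype B'] in
theorem environmentMap_apply (U : Matrix (A' × B') (A × B) ℂ) (σ : Matrix B B ℂ)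
    (M : Matrix A A ℂ) : environmentMap U σ M = traceFst (evolve U M σ) := rfl

omit [Fintype A'] in
theorem channel_add (U : Matrix (A' × B') (A × B) ℂ) (σ : Matrix B B ℂ) (M N : Matrix A A ℂ) :
    channel U σ (M + N) = channel U σ M + channel U σ N := by
  rw [channel, evolve_add]; ext i j; simp [channel, traceSnd, Finset.sum_add_distrib]

omit [Fintype A'] in
theorem channel_smul (U : Matrix (A' × B') (A × B) ℂ) (σ : Matrix B B ℂ) (c : ℂ)
    (M : Matrix A A ℂ) : channel U σ (c • M) = c • channel U σ M := by
  rw [channel, evolve_smul]; ext i j; simp [channel, traceSnd, Finset.mul_sum]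

theorem expect_add {m : Type*} [Fintype m] (X M N : Matrix m m ℂ) :
    expect X (M + N) = expect X M + expect X N := by
  simp [expect, Matrix.mul_add]

theorem expect_real_smul {m : Type*} [Fintype m] (X M : Matrix m m ℂ) (c : ℝ) :
    expect X ((c : ℂ) • M) = c * expect X M := by
  simp [expect]

/-- The linear functional which sends a state to its deviation `Δ`. -/
noncomputable def deviationMap (U : Matrix (A' × B') (A × B) ℂ) (σ : Matrix B B ℂ)
    (XA : Matrix A A ℂ) (XA' : Matrix A' A' ℂ) (ρ : Matrix A A ℂ) : Matrix A A ℂ →ₗ[ℝ] ℝ where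
  -- Weighting the offset by the trace makes the map linear and zero at `ρ`.
  toFun M := (expect XA M - expect XA' (channel U σ M)) -
    (expect XA ρ - expect XA' (channel U σ ρ)) * M.trace.re
  map_add' M N := by
    rw [channel_add, expect_add, expect_add, Matrix.trace_add, Complex.add_re]; ring
  map_smul' c M := by
    rw [← Complex.coe_smul, channel_smul, expect_real_smul, expect_real_smul, Matrix.trace_smul,
      smul_eq_mul, Complex.re_ofReal_mul, smul_eq_mul, RingHom.id_apply]; ring

theorem deviationMap_apply (U : Matrix (A' × B') (A × B) ℂ) (σ : Matrix B B ℂ)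
    (XA : Matrix A A ℂ) (XA' : Matrix A' A' ℂ) (ρ M : Matrix A A ℂ) :
    deviationMap U σ XA XA' ρ M = (expect XA M - expect XA' (channel U σ M)) -
      (expect XA ρ - expect XA' (channel U σ ρ)) * M.trace.re := rfl

theorem deviationMap_of_trace_eq_one (U : Matrix (A' × B') (A × B) ℂ) (σ : Matrix B B ℂ)
    (XA : Matrix A A ℂ) (XA' : Matrix A' A' ℂ) (ρ : Matrix A A ℂ) {M : Matrix A A ℂ}
    (hM : M.trace = 1) : deviationMap U σ XA XA' ρ M = deviation U σ XA XA' ρ M := by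
  rw [deviationMap_apply, deviation, hM, Complex.one_re, mul_one]

variable [DecidableEq A] [DecidableEq B] [DecidableEq A'] [DecidableEq B']

omit [DecidableEq A'] [DecidableEq B'] in
theorem trace_evolve {U : Matrix (A' × B') (A × B) ℂ} (hU : Uᴴ * U = 1) (M : Matrix A A ℂ)
    (σ : Matrix B B ℂ) : (evolve U M σ).trace = M.trace * σ.trace := by
  rw [evolve, Matrix.trace_mul_comm, ← Matrix.mul_assoc, hU, Matrix.one_mul,
    Matrix.trace_kronecker]

/-- The balance of the expectation values of the conserved quantity. -/
theorem trace_conservation {U : Matrix (A' × B') (A × B) ℂ} (hU : Uᴴ * U = 1)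
    {XA : Matrix A A ℂ} {XB : Matrix B B ℂ} {XA' : Matrix A' A' ℂ} {XB' : Matrix B' B' ℂ}
    (hX : U * (XA ⊗ₖ (1 : Matrix B B ℂ) + (1 : Matrix A A ℂ) ⊗ₖ XB) * Uᴴ =
      XA' ⊗ₖ (1 : Matrix B' B' ℂ) + (1 : Matrix A' A' ℂ) ⊗ₖ XB')
    (M : Matrix A A ℂ) (σ : Matrix B B ℂ) :
    (XA' * channel U σ M).trace + (XB' * environmentMap U σ M).trace =
      (XA * M).trace * σ.trace + M.trace * (XB * σ).trace := by
  have h1 : (evolve U M σ * (XA' ⊗ₖ (1 : Matrix B' B' ℂ) + (1 : Matrix A' A' ℂ) ⊗ₖ XB')).trace =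
      (XA' * channel U σ M).trace + (XB' * environmentMap U σ M).trace := by
    rw [Matrix.mul_add, Matrix.trace_add, trace_mul_kronecker_one, trace_mul_one_kronecker,
      Matrix.trace_mul_comm, Matrix.trace_mul_comm (traceFst _)]
    rfl
  rw [← h1, ← hX, evolve]
  have h2 : U * (M ⊗ₖ σ) * Uᴴ * (U * (XA ⊗ₖ (1 : Matrix B B ℂ) + (1 : Matrix A A ℂ) ⊗ₖ XB) * Uᴴ) =
      U * ((M ⊗ₖ σ) * (XA ⊗ₖ (1 : Matrix B B ℂ) + (1 : Matrix A A ℂ) ⊗ₖ XB) * Uᴴ) := by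
    simp only [Matrix.mul_assoc]
    rw [← Matrix.mul_assoc Uᴴ U, hU, Matrix.one_mul]
  rw [h2, Matrix.trace_mul_comm, Matrix.mul_assoc _ Uᴴ, hU, Matrix.mul_one, Matrix.mul_add,
    ← Matrix.mul_kronecker_mul, ← Matrix.mul_kronecker_mul, Matrix.trace_add,
    Matrix.trace_kronecker, Matrix.trace_kronecker, Matrix.mul_one, Matrix.mul_one,
    Matrix.trace_mul_comm M, Matrix.trace_mul_comm σ]

/-- The balance law moves the change on the system to `B'`; the contribution of `XB` is proportional
to the trace and cancels against that of `ρ`. -/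
theorem deviationMap_eq {U : Matrix (A' × B') (A × B) ℂ} (hU : Uᴴ * U = 1)
    {XA : Matrix A A ℂ} {XB : Matrix B B ℂ} {XA' : Matrix A' A' ℂ} {XB' : Matrix B' B' ℂ}
    (hX : U * (XA ⊗ₖ (1 : Matrix B B ℂ) + (1 : Matrix A A ℂ) ⊗ₖ XB) * Uᴴ =
      XA' ⊗ₖ (1 : Matrix B' B' ℂ) + (1 : Matrix A' A' ℂ) ⊗ₖ XB')
    {ρ M : Matrix A A ℂ} {σ : Matrix B B ℂ} (hρ : ρ.trace = 1) (hσ : σ.trace = 1)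
    (hM : M.trace = (M.trace.re : ℂ)) :
    deviationMap U σ XA XA' ρ M =
      ((XB' - ((expect XB' (environmentMap U σ ρ) : ℝ) : ℂ) • 1) *
        environmentMap U σ M).trace.re := by
  have key : ∀ N : Matrix A A ℂ, N.trace = (N.trace.re : ℂ) →
      expect XA N - expect XA' (channel U σ N) =
        expect XB' (environmentMap U σ N) - N.trace.re * expect XB σ := by
    intro N hN
    have h := congrArg Complex.re (trace_conservation hU hX N σ)
    rw [hσ, mul_one, hN, Complex.add_re, Complex.add_re, Complex.re_ofReal_mul] at h
    simp only [expect]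
    linarith
  have htr : (environmentMap U σ M).trace = M.trace := by
    rw [environmentMap_apply, trace_traceFst, trace_evolve hU, hσ, mul_one]
  rw [deviationMap_apply, key M hM, key ρ (by simp [hρ]), hρ, Matrix.sub_mul, Matrix.smul_mul,
    Matrix.one_mul, Matrix.trace_sub, Matrix.trace_smul, htr, smul_eq_mul, Complex.sub_re,
    Complex.re_ofReal_mul]
  simp only [Complex.one_re, expect]
  ring

end Evolution

/-! ### Steering by effects on the reference -/

section Steering

variable {A R : Type*} [Fintype A] [Fintype R] [DecidableEq A] [DecidableEq R]

/-- Every matrix `M` between `0` and `Ψ Ψ†` is of the form `Ψ E Ψ†` with `0 ≤ E ≤ 1`. -/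
theorem exists_effect {Ψ : Matrix A R ℂ} {M : Matrix A A ℂ} (hM : M.PosSemidef)
    (hM' : (Ψ * Ψᴴ - M).PosSemidef) :
    ∃ E : Matrix R R ℂ, E.PosSemidef ∧ (1 - E).PosSemidef ∧ Ψ * E * Ψᴴ = M := by
  have hρ : (Ψ * Ψᴴ).PosSemidef := Matrix.posSemidef_self_mul_conjTranspose Ψ
  obtain ⟨g, hg, hcomm, hρgρ, hgρg, -⟩ := exists_pseudoInverse hρ
  set ρ := Ψ * Ψᴴ with hρdef
  have hsupp : M * (ρ * g) = M :=
    mul_support_eq_of_le (c := 1) hg hρ.1 hcomm hρgρ hM (by simpa using hM')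
  have hsupp' : ρ * g * M = M := by
    have := congrArg Matrix.conjTranspose hsupp
    rwa [Matrix.conjTranspose_mul, Matrix.conjTranspose_mul, hg.eq, hρ.1.eq, hM.1.eq,
      ← hcomm] at this
  -- `Ψ * Sᴴ` is the support projection of `ρ`, so `Sᴴ * M * S` is sent back to `M`; it is at most
  -- `Sᴴ * ρ * S`, a projection, hence at most 1.
  set S := g * Ψ with hS
  have hSh : Sᴴ = Ψᴴ * g := by rw [hS, Matrix.conjTranspose_mul, hg.eq]
  refine ⟨Sᴴ * M * S, hM.conjTranspose_mul_mul_same S, ?_, ?_⟩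
  · have h1 := hM'.conjTranspose_mul_mul_same S
    have hT : Sᴴ * ρ * S = Ψᴴ * g * Ψ := by
      rw [hSh, hS, Matrix.mul_assoc, ← Matrix.mul_assoc ρ, ← Matrix.mul_assoc, Matrix.mul_assoc Ψᴴ,
        ← Matrix.mul_assoc g, hgρg]
    have hTh : (Ψᴴ * g * Ψ)ᴴ = Ψᴴ * g * Ψ := by
      simp only [Matrix.conjTranspose_mul, hg.eq, Matrix.conjTranspose_conjTranspose,
        Matrix.mul_assoc]
    have hTT : (Ψᴴ * g * Ψ) * (Ψᴴ * g * Ψ) = Ψᴴ * g * Ψ := by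
      have : (Ψᴴ * g * Ψ) * (Ψᴴ * g * Ψ) = Ψᴴ * (g * (Ψ * Ψᴴ) * g) * Ψ := by
        simp only [Matrix.mul_assoc]
      rw [this, ← hρdef, hgρg]
    have h2 := Matrix.posSemidef_conjTranspose_mul_self (1 - Ψᴴ * g * Ψ)
    rw [Matrix.conjTranspose_sub, hTh, Matrix.conjTranspose_one, Matrix.mul_sub, Matrix.mul_one,
      Matrix.sub_mul, hTT, Matrix.one_mul, sub_self, sub_zero] at h2
    rw [Matrix.mul_sub, Matrix.sub_mul, hT] at h1
    simpa using h2.add h1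
  · have : Ψ * (Sᴴ * M * S) * Ψᴴ = ρ * g * (M * (g * ρ)) := by
      rw [hSh, hS, hρdef]; simp only [Matrix.mul_assoc]
    rw [this, ← hcomm, hsupp, hsupp']

/-- $1-(2E-1)^2=4E(1-E)=4\big(E(1-E)E+(1-E)E(1-E)\big)$, which is manifestly positive. -/
theorem one_sub_mul_self_posSemidef {E : Matrix R R ℂ} (hE : E.PosSemidef)
    (hE' : (1 - E).PosSemidef) :
    (1 - (((2 : ℝ) : ℂ) • E - 1) * (((2 : ℝ) : ℂ) • E - 1)).PosSemidef := by
  have h1 := hE'.conjTranspose_mul_mul_same E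
  have h2 := hE.conjTranspose_mul_mul_same (1 - E)
  have h3 := posSemidef_real_smul (h1.add h2) (c := 4) (by norm_num)
  convert h3 using 1
  rw [hE.1.eq, hE'.1.eq, Complex.coe_smul, Complex.coe_smul]
  simp only [Matrix.mul_sub, Matrix.sub_mul, Matrix.mul_one, Matrix.one_mul, Matrix.smul_mul,
    Matrix.mul_smul, smul_sub, smul_add]
  module

end Steering

end QRecovery

namespace QRecovery

/-! ### Correlations of the reference and the environment -/

section Correlation

variable {A B A' B' RA RB : Type*}
  [Fintype A] [Fintype B] [Fintype A'] [Fintype B'] [Fintype RA] [Fintype RB]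
  [DecidableEq RA] [DecidableEq RB]

theorem totalFinal_posSemidef (U : Matrix (A' × B') (A × B) ℂ) (ψ : A × RA → ℂ)
    (φ : B × RB → ℂ) : (totalFinal U ψ φ).PosSemidef :=
  (((pureState_posSemidef ψ).kronecker (pureState_posSemidef φ)).submatrix _
    ).mul_mul_conjTranspose_same _

omit [Fintype A'] [Fintype B'] in
theorem totalFinal_apply (U : Matrix (A' × B') (A × B) ℂ) (ψ : A × RA → ℂ) (φ : B × RB → ℂ)
    (x y : A' × B') (r r' : RA) (s s' : RB) :
    totalFinal U ψ φ (x, (r, s)) (y, (r', s')) =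
      evolve U (Matrix.vecMulVec (fun a => ψ (a, r)) (star fun a => ψ (a, r')))
        (Matrix.vecMulVec (fun b => φ (b, s)) (star fun b => φ (b, s'))) x y := by
  simp only [totalFinal, evolve, Matrix.mul_apply, Fintype.sum_prod_type,
    Matrix.conjTranspose_apply, Matrix.kroneckerMap_apply, Matrix.submatrix_apply,
    Equiv.prodProdProdComm_apply, Matrix.one_apply, Prod.mk.injEq]
  simp [ite_and, apply_ite (starRingEnd ℂ), pureState, Matrix.vecMulVec_apply]

/-- The total final state, with the factors grouped as `A' RB`, `RA B'`. -/
def groupedFinal (U : Matrix (A' × B') (A × B) ℂ) (ψ : A × RA → ℂ) (φ : B × RB → ℂ) :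
    Matrix ((A' × RB) × (RA × B')) ((A' × RB) × (RA × B')) ℂ :=
  (totalFinal U ψ φ).submatrix (fun x => ((x.1.1, x.2.2), (x.2.1, x.1.2)))
    (fun x => ((x.1.1, x.2.2), (x.2.1, x.1.2)))

/-- The state after the recovery, with the factors in the order `A`, `RA`, `B'`. -/
def recoveredFinal (U : Matrix (A' × B') (A × B) ℂ) (ψ : A × RA → ℂ) (φ : B × RB → ℂ)
    (R : Matrix (A' × RB) (A' × RB) ℂ →ₗ[ℂ] Matrix A A ℂ) :
    Matrix ((A × RA) × B') ((A × RA) × B') ℂ :=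
  (tensorId R (groupedFinal U ψ φ)).submatrix (fun y => (y.1.1, (y.1.2, y.2)))
    (fun y => (y.1.1, (y.1.2, y.2)))

theorem recoveredFinal_posSemidef (U : Matrix (A' × B') (A × B) ℂ) (ψ : A × RA → ℂ)
    (φ : B × RB → ℂ) {R : Matrix (A' × RB) (A' × RB) ℂ →ₗ[ℂ] Matrix A A ℂ} (hR : IsCPTP R) :
    (recoveredFinal U ψ φ R).PosSemidef :=
  (hR.tensorId_posSemidef ((totalFinal_posSemidef U ψ φ).submatrix _)).submatrix _

theorem accessibleFinal_posSemidef (U : Matrix (A' × B') (A × B) ℂ) (ψ : A × RA → ℂ)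
    (φ : B × RB → ℂ) : (accessibleFinal U ψ φ).PosSemidef :=
  traceSnd_posSemidef ((totalFinal_posSemidef U ψ φ).submatrix _)

omit [Fintype A'] in
-- Recovery does not touch `B'`, so it commutes with tracing out `B'`. This ties the purified
-- distance to the state kept on `A RA B'`.
theorem traceSnd_recoveredFinal (U : Matrix (A' × B') (A × B) ℂ) (ψ : A × RA → ℂ)
    (φ : B × RB → ℂ) (R : Matrix (A' × RB) (A' × RB) ℂ →ₗ[ℂ] Matrix A A ℂ) :
    traceSnd (recoveredFinal U ψ φ R) = tensorId R (accessibleFinal U ψ φ) := by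
  refine Matrix.ext fun x y => ?_
  have h : (Matrix.of fun u v => accessibleFinal U ψ φ (u, x.2) (v, y.2)) =
      ∑ b : B', Matrix.of fun u v => groupedFinal U ψ φ (u, (x.2, b)) (v, (y.2, b)) := by
    ext u v
    rw [Matrix.sum_apply]
    rfl
  change ∑ b : B', R (Matrix.of fun u v => groupedFinal U ψ φ (u, (x.2, b)) (v, (y.2, b))) x.1 y.1
    = R (Matrix.of fun u v => accessibleFinal U ψ φ (u, x.2) (v, y.2)) x.1 y.1
  rw [h, map_sum, Matrix.sum_apply]

theorem traceFst_tensorId {m n k : Type*} [Fintype m] [Fintype n]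
    {Φ : Matrix m m ℂ →ₗ[ℂ] Matrix n n ℂ} (hΦ : IsCPTP Φ) (M : Matrix (m × k) (m × k) ℂ) :
    traceFst (tensorId Φ M) = traceFst M := by
  ext i j
  exact hΦ.2 (Matrix.of fun a b => M (a, i) (b, j))

omit [Fintype B'] in
theorem traceFst_groupedFinal (U : Matrix (A' × B') (A × B) ℂ) (ψ : A × RA → ℂ)
    (φ : B × RB → ℂ) (r r' : RA) (b b' : B') :
    traceFst (groupedFinal U ψ φ) (r, b) (r', b') =
      environmentMap U (traceSnd (pureState φ))
        (Matrix.vecMulVec (fun a => ψ (a, r)) (star fun a => ψ (a, r'))) b b' := by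
  have h : traceSnd (pureState φ) =
      ∑ s, Matrix.vecMulVec (fun b => φ (b, s)) (star fun b => φ (b, s)) := by
    ext i j
    rw [Matrix.sum_apply]
    rfl
  have hev : ∀ M : Matrix A A ℂ, evolve U M (traceSnd (pureState φ)) =
      ∑ s, evolve U M (Matrix.vecMulVec (fun b => φ (b, s)) (star fun b => φ (b, s))) := by
    intro M
    have : M ⊗ₖ traceSnd (pureState φ) =
        ∑ s, M ⊗ₖ Matrix.vecMulVec (fun b => φ (b, s)) (star fun b => φ (b, s)) := by
      rw [h]
      ext i j
      simp [Matrix.sum_apply, Finset.mul_sum]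
    simp only [evolve, this, Matrix.mul_sum, Matrix.sum_mul]
  rw [environmentMap_apply, hev]
  simp only [traceFst, Matrix.of_apply, groupedFinal, Matrix.submatrix_apply,
    Fintype.sum_prod_type, totalFinal_apply, Matrix.sum_apply]

/-- The correlations of the references `RA` and the environment `B'` are not affected by the
recovery. -/
theorem trace_recoveredFinal_mul [DecidableEq A] (U : Matrix (A' × B') (A × B) ℂ)
    (ψ : A × RA → ℂ) (φ : B × RB → ℂ)
    {R : Matrix (A' × RB) (A' × RB) ℂ →ₗ[ℂ] Matrix A A ℂ} (hR : IsCPTP R)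
    (O : Matrix RA RA ℂ) (Z : Matrix B' B' ℂ) :
    (recoveredFinal U ψ φ R * (((1 : Matrix A A ℂ) ⊗ₖ O) ⊗ₖ Z)).trace =
      (Z * environmentMap U (traceSnd (pureState φ))
        ((Matrix.of fun a r => ψ (a, r)) * Oᵀ * (Matrix.of fun a r => ψ (a, r))ᴴ)).trace := by
  have hL : (recoveredFinal U ψ φ R * (((1 : Matrix A A ℂ) ⊗ₖ O) ⊗ₖ Z)).trace =
      (tensorId R (groupedFinal U ψ φ) * ((1 : Matrix A A ℂ) ⊗ₖ (O ⊗ₖ Z))).trace := by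
    rw [recoveredFinal, Matrix.trace, Matrix.trace,
      ← Equiv.sum_comp (Equiv.prodAssoc A RA B')]
    refine Finset.sum_congr rfl fun x _ => ?_
    rw [Matrix.diag_apply, Matrix.diag_apply, Matrix.mul_apply, Matrix.mul_apply,
      ← Equiv.sum_comp (Equiv.prodAssoc A RA B')]
    refine Finset.sum_congr rfl fun y _ => ?_
    simp [mul_assoc]
  -- An observable on the reference acts on the coefficient matrix from the right, hence the
  -- transpose.
  have hM : (Matrix.of fun a r => ψ (a, r)) * Oᵀ * (Matrix.of fun a r => ψ (a, r))ᴴ =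
      ∑ r, ∑ r', O r' r • Matrix.vecMulVec (fun a => ψ (a, r)) (star fun a => ψ (a, r')) := by
    ext a a'
    simp only [Matrix.mul_apply, Matrix.sum_apply, Matrix.smul_apply, Matrix.vecMulVec_apply,
      Matrix.of_apply, Matrix.transpose_apply, Matrix.conjTranspose_apply, Finset.sum_mul,
      smul_eq_mul, Pi.star_apply]
    rw [Finset.sum_comm]
    refine Finset.sum_congr rfl fun r _ => Finset.sum_congr rfl fun r' _ => ?_
    ring
  rw [hL, trace_mul_one_kronecker, traceFst_tensorId hR, hM, map_sum]
  simp only [map_sum, map_smul, Matrix.mul_sum, Matrix.trace_sum, Matrix.mul_smul,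
    Matrix.trace_smul, smul_eq_mul]
  rw [Matrix.trace, Fintype.sum_prod_type]
  refine Finset.sum_congr rfl fun r _ => ?_
  simp only [Matrix.diag_apply, Matrix.mul_apply, Fintype.sum_prod_type, Matrix.kronecker_apply,
    traceFst_groupedFinal]
  rw [Finset.sum_comm]
  refine Finset.sum_congr rfl fun r' _ => ?_
  rw [Matrix.trace_mul_comm, Matrix.trace, Finset.mul_sum]
  refine Finset.sum_congr rfl fun b _ => ?_
  rw [Matrix.diag_apply, Matrix.mul_apply, Finset.mul_sum]
  refine Finset.sum_congr rfl fun b' _ => ?_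
  ring

end Correlation

/-! ### The trade-off between fluctuation and recovery error -/

section Bound

variable {A B A' B' RA RB : Type*}
  [Fintype A] [Fintype B] [Fintype A'] [Fintype B'] [Fintype RA] [Fintype RB]
  [DecidableEq A] [DecidableEq B] [DecidableEq A'] [DecidableEq B']
  [DecidableEq RA] [DecidableEq RB]

omit [Fintype A] [DecidableEq A] [DecidableEq RA] in
theorem traceSnd_pureState (ψ : A × RA → ℂ) :
    traceSnd (pureState ψ) =
      (Matrix.of fun a r => ψ (a, r)) * (Matrix.of fun a r => ψ (a, r))ᴴ := by
  ext i j
  simp [traceSnd, pureState, Matrix.mul_apply, Matrix.vecMulVec_apply]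

omit [DecidableEq A] [DecidableEq RA] in
theorem isDensity_traceSnd_pureState {ψ : A × RA → ℂ} (hψ : IsUnitVector ψ) :
    IsDensity (traceSnd (pureState ψ)) := by
  refine ⟨traceSnd_posSemidef (pureState_posSemidef ψ), ?_⟩
  rw [trace_traceSnd, pureState, Matrix.trace_vecMulVec, dotProduct_comm, hψ]

/-- The trade-off between the fluctuation of the conserved quantity and the recovery error. -/
theorem deviationMap_le_purifiedDist {ψ : A × RA → ℂ} (hψ : IsUnitVector ψ) {φ : B × RB → ℂ}
    (hφ : IsUnitVector φ) {U : Matrix (A' × B') (A × B) ℂ} (hU : Uᴴ * U = 1)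
    {XA : Matrix A A ℂ} {XB : Matrix B B ℂ} {XA' : Matrix A' A' ℂ} {XB' : Matrix B' B' ℂ}
    (hXB' : XB'.IsHermitian)
    (hX : U * (XA ⊗ₖ (1 : Matrix B B ℂ) + (1 : Matrix A A ℂ) ⊗ₖ XB) * Uᴴ =
      XA' ⊗ₖ (1 : Matrix B' B' ℂ) + (1 : Matrix A' A' ℂ) ⊗ₖ XB')
    {M : Matrix A A ℂ} (hM : M.PosSemidef) (hM' : (traceSnd (pureState ψ) - M).PosSemidef)
    {R : Matrix (A' × RB) (A' × RB) ℂ →ₗ[ℂ] Matrix A A ℂ} (hR : IsCPTP R)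
    {Z : Matrix B' B' ℂ} {σ : Matrix B' B' ℂ}
    (hσ : σ = environmentMap U (traceSnd (pureState φ)) (traceSnd (pureState ψ)))
    (hZ : Z = XB' - ((expect XB' σ : ℝ) : ℂ) • 1) :
    2 * deviationMap U (traceSnd (pureState φ)) XA XA' (traceSnd (pureState ψ)) M ≤
      4 * purifiedDist (pureState ψ) (tensorId R (accessibleFinal U ψ φ)) *
        Real.sqrt (Z * Z * σ).trace.re := by
  have hρA := isDensity_traceSnd_pureState hψ
  have hρB := isDensity_traceSnd_pureState hφ
  set Ψ : Matrix A RA ℂ := Matrix.of fun a r => ψ (a, r) with hΨ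
  have hρΨ : traceSnd (pureState ψ) = Ψ * Ψᴴ := traceSnd_pureState ψ
  obtain ⟨E, hE, hE', hEM⟩ := exists_effect (Ψ := Ψ) hM (by rwa [← hρΨ])
  -- Centring the effect to a contraction with values in $[-1,1]$ doubles the correlation, as `M`
  -- becomes `2 M - ρA` and `ρA` contributes zero.
  set W : Matrix RA RA ℂ := ((2 : ℝ) : ℂ) • E - 1 with hW
  have hWh : W.IsHermitian :=
    (posSemidef_real_smul hE zero_le_two).1.sub Matrix.isHermitian_one
  have hWW : (1 - Wᵀ * Wᵀ).PosSemidef := by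
    have := (one_sub_mul_self_posSemidef hE hE').transpose
    rwa [Matrix.transpose_sub, Matrix.transpose_one, Matrix.transpose_mul] at this
  have hZh : Z.IsHermitian := by
    rw [hZ]
    refine hXB'.sub ?_
    rw [Matrix.IsHermitian, Matrix.conjTranspose_smul, Matrix.conjTranspose_one]
    simp
  set ω := recoveredFinal U ψ φ R with hωdef
  have hω : ω.PosSemidef := recoveredFinal_posSemidef U ψ φ hR
  have hcorr := trace_recoveredFinal_mul U ψ φ hR
  rw [← hΨ] at hcorr
  have hone : ∀ Y : Matrix B' B' ℂ,
      (ω * ((1 : Matrix (A × RA) (A × RA) ℂ) ⊗ₖ Y)).trace = (Y * σ).trace := by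
    intro Y
    have := hcorr 1 Y
    rwa [Matrix.one_kronecker_one, Matrix.transpose_one, Matrix.mul_one, ← hρΨ, ← hσ] at this
  have hσtr : σ.trace = 1 := by
    rw [hσ, environmentMap_apply, trace_traceFst, trace_evolve hU, hρA.2, hρB.2, mul_one]
  have hωtr : ω.trace = 1 := by
    have := hone 1
    rwa [Matrix.one_kronecker_one, Matrix.mul_one, Matrix.one_mul, hσtr] at this
  have hσpos : σ.PosSemidef := by
    have : σ = traceFst ω := by
      refine Matrix.ext_iff_trace_mul_right.2 fun Y => ?_
      rw [← trace_mul_one_kronecker, hone, Matrix.trace_mul_comm]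
    rw [this]
    exact traceFst_posSemidef hω
  set K : Matrix (A × RA) (A × RA) ℂ := (1 : Matrix A A ℂ) ⊗ₖ Wᵀ with hK
  have hKh : K.IsHermitian := by
    rw [Matrix.IsHermitian, hK, Matrix.conjTranspose_kronecker, Matrix.conjTranspose_one,
      hWh.transpose.eq]
  have hKK : (1 - K * K).PosSemidef := by
    have : 1 - K * K = (1 : Matrix A A ℂ) ⊗ₖ (1 - Wᵀ * Wᵀ) := by
      rw [hK, ← Matrix.mul_kronecker_mul, Matrix.mul_one, sub_eq_iff_eq_add,
        ← Matrix.kronecker_add, sub_add_cancel, Matrix.one_kronecker_one]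
    rw [this]
    exact Matrix.PosSemidef.one.kronecker hWW
  set o : ℂ := star ψ ⬝ᵥ K *ᵥ ψ with ho
  have hoim : o.im = 0 := hKh.im_star_dotProduct_mulVec_self ψ
  have hore : o = (o.re : ℂ) := Complex.ext rfl (by simpa using hoim)
  have hp1 : (pureState ψ).trace = 1 := by
    rw [pureState, Matrix.trace_vecMulVec, dotProduct_comm, hψ]
  have ho1 : |o.re| ≤ 1 := by
    have h1 := norm_trace_mul_le (pureState_posSemidef ψ) 1 K
    have h2 := trace_mul_re_mono (pureState_posSemidef ψ) hKK
    rw [Matrix.conjTranspose_one, Matrix.one_mul, Matrix.one_mul, Matrix.mul_one, hp1,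
      Matrix.trace_mul_comm, trace_mul_pureState, hKh.eq, Complex.one_re, Real.sqrt_one,
      one_mul] at h1
    rw [Matrix.mul_one, hp1, Complex.one_re] at h2
    exact ((Complex.abs_re_le_norm o).trans h1).trans (Real.sqrt_le_one.2 h2)
  -- On the range of `ψ ⊗ 1` the observable `K ⊗ 1` compresses to its expectation in `ψ`; this is
  -- where purity of `ψ` enters.
  have key := trace_correlation_le (ω := ω) (Q := pureState ψ ⊗ₖ (1 : Matrix B' B' ℂ))
    (Z := (1 : Matrix (A × RA) (A × RA) ℂ) ⊗ₖ Z) (O := K ⊗ₖ (1 : Matrix B' B' ℂ)) (o := o.re) hω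
    (by rw [Matrix.IsHermitian, Matrix.conjTranspose_kronecker, Matrix.conjTranspose_one,
          (pureState_posSemidef ψ).1.eq])
    (by rw [← Matrix.mul_kronecker_mul, pureState_mul_self hψ, Matrix.mul_one])
    (by rw [Matrix.IsHermitian, Matrix.conjTranspose_kronecker, Matrix.conjTranspose_one, hZh.eq])
    (by rw [Matrix.IsHermitian, Matrix.conjTranspose_kronecker, Matrix.conjTranspose_one, hKh.eq])
    (by simp only [← Matrix.mul_kronecker_mul, Matrix.mul_one, Matrix.one_mul])
    (by simp only [← Matrix.mul_kronecker_mul, Matrix.mul_one, Matrix.one_mul])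
    (by
      rw [← Matrix.mul_kronecker_mul, ← Matrix.mul_kronecker_mul, Matrix.mul_one, Matrix.mul_one,
        pureState_mul_mul_pureState, Matrix.smul_kronecker, ← ho, ← hore])
    ho1
    (by
      have : 1 - K ⊗ₖ (1 : Matrix B' B' ℂ) * K ⊗ₖ (1 : Matrix B' B' ℂ) =
          (1 - K * K) ⊗ₖ (1 : Matrix B' B' ℂ) := by
        rw [← Matrix.mul_kronecker_mul, Matrix.mul_one, sub_eq_iff_eq_add,
          ← Matrix.add_kronecker, sub_add_cancel, Matrix.one_kronecker_one]
      rw [this]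
      exact hKK.kronecker Matrix.PosSemidef.one)
    (by
      have him : (XB' * σ).trace = (((XB' * σ).trace.re : ℝ) : ℂ) := by
        refine Complex.ext rfl ?_
        rw [Complex.ofReal_im, ← Complex.conj_eq_iff_im, ← Complex.star_def,
          ← Matrix.trace_conjTranspose, Matrix.conjTranspose_mul, hXB'.eq, hσpos.1.eq,
          Matrix.trace_mul_comm]
      rw [hone, hZ, Matrix.sub_mul, Matrix.smul_mul, Matrix.one_mul, Matrix.trace_sub,
        Matrix.trace_smul, hσtr, smul_eq_mul, mul_one, expect, ← him, sub_self])
  have hlhs : (ω * ((1 : Matrix (A × RA) (A × RA) ℂ) ⊗ₖ Z * K ⊗ₖ (1 : Matrix B' B' ℂ))).trace.re =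
      2 * deviationMap U (traceSnd (pureState φ)) XA XA' (traceSnd (pureState ψ)) M := by
    rw [← Matrix.mul_kronecker_mul, Matrix.mul_one, Matrix.one_mul, hK, hcorr,
      Matrix.transpose_transpose,
      deviationMap_eq hU hX hρA.2 hρB.2 (trace_eq_ofReal hM), ← hσ, ← hZ]
    have h0 : deviationMap U (traceSnd (pureState φ)) XA XA' (traceSnd (pureState ψ))
        (traceSnd (pureState ψ)) = 0 := by
      rw [deviationMap_of_trace_eq_one _ _ _ _ _ hρA.2, deviation, sub_self]
    rw [deviationMap_eq hU hX hρA.2 hρB.2 (trace_eq_ofReal hρA.1), ← hσ, ← hZ] at h0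
    have : Ψ * W * Ψᴴ = ((2 : ℝ) : ℂ) • M - traceSnd (pureState ψ) := by
      rw [hW, Matrix.mul_sub, Matrix.sub_mul, Matrix.mul_one, ← hρΨ, Matrix.mul_smul,
        Matrix.smul_mul, hEM]
    rw [this, map_sub, map_smul, ← hσ, Matrix.mul_sub, Matrix.mul_smul, Matrix.trace_sub,
      Matrix.trace_smul, Complex.sub_re, h0, smul_eq_mul, Complex.re_ofReal_mul, sub_zero]
  -- For pure `ψ` the squared purified distance is exactly the weight of `ω` outside `ψ ⊗ 1`.
  have hδ : Real.sqrt (ω * (1 - pureState ψ ⊗ₖ (1 : Matrix B' B' ℂ))).trace.re =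
      purifiedDist (pureState ψ) (tensorId R (accessibleFinal U ψ φ)) := by
    rw [purifiedDist_pureState ψ (hR.tensorId_posSemidef (accessibleFinal_posSemidef U ψ φ)),
      Matrix.mul_sub, Matrix.mul_one, Matrix.trace_sub, hωtr, trace_mul_kronecker_one, hωdef,
      traceSnd_recoveredFinal, trace_mul_pureState, Complex.sub_re, Complex.one_re]
  rwa [hlhs, hδ, ← Matrix.mul_kronecker_mul, Matrix.mul_one, hone] at key

/-- The quantum Fisher information of a purification is four times the variance. -/
theorem fisherInfo_purification {n k : Type*} [Fintype n] [Fintype k] [DecidableEq n]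
    [DecidableEq k] {χ : n × k → ℂ} (hχ : IsUnitVector χ) {X σ : Matrix n n ℂ}
    (hX : X.IsHermitian) (hσ : traceSnd (pureState χ) = σ) :
    fisherInfo (pureState χ) (X ⊗ₖ (1 : Matrix k k ℂ)) =
      4 * ((X - ((expect X σ : ℝ) : ℂ) • 1) * (X - ((expect X σ : ℝ) : ℂ) • 1) * σ).trace.re := by
  have hXk : (X ⊗ₖ (1 : Matrix k k ℂ)).IsHermitian := by
    rw [Matrix.IsHermitian, Matrix.conjTranspose_kronecker, Matrix.conjTranspose_one, hX.eq]
  have hval : ∀ Y : Matrix n n ℂ, star χ ⬝ᵥ (Y ⊗ₖ (1 : Matrix k k ℂ)) *ᵥ χ = (Y * σ).trace := by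
    intro Y
    rw [← trace_mul_pureState, Matrix.trace_mul_comm, trace_mul_kronecker_one, hσ,
      Matrix.trace_mul_comm]
  have hσ1 : σ.trace = 1 := by
    rw [← hσ]; exact (isDensity_traceSnd_pureState hχ).2
  rw [fisherInfo_pureState hχ hXk, ← Matrix.mul_kronecker_mul, Matrix.mul_one, hval, hval]
  have e : (X - ((expect X σ : ℝ) : ℂ) • 1) * (X - ((expect X σ : ℝ) : ℂ) • 1) * σ =
      X * X * σ - ((2 * expect X σ : ℝ) : ℂ) • (X * σ) + ((expect X σ ^ 2 : ℝ) : ℂ) • σ := by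
    simp only [Matrix.mul_sub, Matrix.sub_mul, Matrix.mul_smul, Matrix.smul_mul, Matrix.mul_one,
      Matrix.one_mul]
    push_cast
    module
  rw [e, Matrix.trace_add, Matrix.trace_sub, Matrix.trace_smul, Matrix.trace_smul, hσ1,
    smul_eq_mul, smul_eq_mul, mul_one, Complex.add_re, Complex.sub_re, Complex.re_ofReal_mul,
    Complex.ofReal_re]
  simp only [expect]
  ring

end Bound

end QRecovery

/-! ### Main theorem -/

theorem mainTheorem2
    {A B A' B' RA RB R' : Type*}
    [Fintype A] [Fintype B] [Fintype A'] [Fintype B'] [Fintype RA] [Fintype RB] [Fintype R']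
    [DecidableEq A] [DecidableEq B] [DecidableEq A'] [DecidableEq B']
    [DecidableEq RA] [DecidableEq RB] [DecidableEq R']
    (ψ : A × RA → ℂ) (hψ : IsUnitVector ψ)
    (φ : B × RB → ℂ) (hφ : IsUnitVector φ)
    (U : Matrix (A' × B') (A × B) ℂ) (hU : Uᴴ * U = 1) (hU' : U * Uᴴ = 1)
    (XA : Matrix A A ℂ) (XB : Matrix B B ℂ) (XA' : Matrix A' A' ℂ) (XB' : Matrix B' B' ℂ)
    (hXA : XA.IsHermitian) (hXB : XB.IsHermitian)
    (hXA' : XA'.IsHermitian) (hXB' : XB'.IsHermitian)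
    (hX : U * (XA ⊗ₖ (1 : Matrix B B ℂ) + (1 : Matrix A A ℂ) ⊗ₖ XB) * Uᴴ =
      XA' ⊗ₖ (1 : Matrix B' B' ℂ) + (1 : Matrix A' A' ℂ) ⊗ₖ XB')
    (ρA : Matrix A A ℂ) (hρA : ρA = traceSnd (pureState ψ))
    (ρB : Matrix B B ℂ) (hρB : ρB = traceSnd (pureState φ))
    (χ : B' × R' → ℂ) (hχ : traceSnd (pureState χ) = traceFst (evolve U ρA ρB)) :
    IsLeast (recoveryErrors U ψ φ) (recoveryError U ψ φ) ∧
    IsGreatest (sumValues U ρB XA XA' ρA) (fluctuationSum U ρB XA XA' ρA) ∧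
    IsGreatest (termValues U ρB XA XA' ρA) (fluctuationTerm U ρB XA XA' ρA) ∧
    IsGreatest (deviationValues U ρB XA XA' ρA) (deltaMax U ρB XA XA' ρA) ∧
    (∃ L : ℝ, Tendsto (fisherQuotient (pureState χ) (XB' ⊗ₖ (1 : Matrix R' R' ℂ)))
      (𝓝[≠] (0 : ℝ)) (𝓝 L)) ∧
    fluctuationSum U ρB XA XA' ρA /
      (2 * (Real.sqrt (fisherInfo (pureState χ) (XB' ⊗ₖ (1 : Matrix R' R' ℂ))) +
        deltaMax U ρB XA XA' ρA)) ≤ recoveryError U ψ φ ∧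
    fluctuationTerm U ρB XA XA' ρA /
      (2 * (Real.sqrt (fisherInfo (pureState χ) (XB' ⊗ₖ (1 : Matrix R' R' ℂ))) +
        deltaMax U ρB XA XA' ρA)) ≤ recoveryError U ψ φ := by
  subst hρA hρB
  have hρA := isDensity_traceSnd_pureState hψ
  have hρB := isDensity_traceSnd_pureState hφ
  set G := deviationMap U (traceSnd (pureState φ)) XA XA' (traceSnd (pureState ψ)) with hG
  have hdev : ∀ M : Matrix A A ℂ, IsDensity M →
      deviation U (traceSnd (pureState φ)) XA XA' (traceSnd (pureState ψ)) M = G M :=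
    fun M hM => (deviationMap_of_trace_eq_one _ _ _ _ _ hM.2).symm
  have hG0 : G (traceSnd (pureState ψ)) = 0 := by
    rw [← hdev _ hρA, deviation, sub_self]
  obtain ⟨M, hM, hM', hsum, hterm⟩ := exists_isGreatest_decomposition G hρA hG0
  obtain ⟨D, hD⟩ := exists_isGreatest_member G hρA
  obtain ⟨δ, hδ⟩ := exists_isLeast_purifiedDist hψ (accessibleFinal_posSemidef U ψ φ)
  have hsum' : IsGreatest (sumValues U (traceSnd (pureState φ)) XA XA' (traceSnd (pureState ψ)))
      (2 * G M) := by
    convert hsum using 1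
    ext x
    refine exists_congr fun d => exists_congr fun p => exists_congr fun ρs =>
      and_congr_right fun h => ?_
    rw [Finset.sum_congr rfl fun j _ => by rw [hdev _ (h.2.2.1 j)]]
  have hterm' : IsGreatest (termValues U (traceSnd (pureState φ)) XA XA' (traceSnd (pureState ψ)))
      (G M) := by
    convert hterm using 1
    ext x
    refine exists_congr fun d => exists_congr fun p => exists_congr fun ρs =>
      and_congr_right fun h => exists_congr fun j => ?_
    rw [hdev _ (h.2.2.1 j)]
  have hD' : IsGreatest
      (deviationValues U (traceSnd (pureState φ)) XA XA' (traceSnd (pureState ψ))) D := by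
    convert hD using 1
    ext x
    refine exists_congr fun d => exists_congr fun p => exists_congr fun ρs =>
      and_congr_right fun h => exists_congr fun j => ?_
    rw [hdev _ (h.2.2.1 j)]
  have hδ' : IsLeast (recoveryErrors U ψ φ) δ := hδ
  have e1 : recoveryError U ψ φ = δ := hδ'.csInf_eq
  have e2 : fluctuationSum U (traceSnd (pureState φ)) XA XA' (traceSnd (pureState ψ)) = 2 * G M :=
    hsum'.csSup_eq
  have e3 : fluctuationTerm U (traceSnd (pureState φ)) XA XA' (traceSnd (pureState ψ)) = G M :=
    hterm'.csSup_eq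
  have e4 : deltaMax U (traceSnd (pureState φ)) XA XA' (traceSnd (pureState ψ)) = D :=
    hD'.csSup_eq
  -- Normalisation of the purification follows from that of its marginal.
  have hχ1 : IsUnitVector χ := by
    have h := congrArg Matrix.trace hχ
    rwa [trace_traceSnd, trace_traceFst, trace_evolve hU, hρA.2, hρB.2, mul_one, pureState,
      Matrix.trace_vecMulVec, dotProduct_comm] at h
  have hXk : (XB' ⊗ₖ (1 : Matrix R' R' ℂ)).IsHermitian := by
    rw [Matrix.IsHermitian, Matrix.conjTranspose_kronecker, Matrix.conjTranspose_one, hXB'.eq]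
  have hGM : 0 ≤ G M := by
    obtain ⟨d, p, ρs, hdec, j, hj⟩ := hterm.1
    rw [hj]
    exact mul_nonneg (hdec.1 j).le (abs_nonneg _)
  have hD0 : 0 ≤ D := by
    obtain ⟨d, p, ρs, hdec, j, hj⟩ := hD.1
    rw [hj]
    exact abs_nonneg _
  have hδ0 : 0 ≤ δ := by
    obtain ⟨R, hR, h⟩ := hδ.1
    rw [h]
    exact Real.sqrt_nonneg _
  -- An optimal recovery gives $2G(M)\le4\delta\sqrt{\operatorname{Var}}$, and $\sqrt{\mathcal
  -- F_f}=2\sqrt{\operatorname{Var}}$.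
  have hbound : 2 * G M ≤
      δ * (2 * Real.sqrt (fisherInfo (pureState χ) (XB' ⊗ₖ (1 : Matrix R' R' ℂ)))) := by
    obtain ⟨R, hR, h⟩ := hδ.1
    have hb := deviationMap_le_purifiedDist hψ hφ hU hXB' hX hM hM' hR rfl rfl
    rw [← h] at hb
    rw [fisherInfo_purification hχ1 hXB' hχ, Real.sqrt_mul (by norm_num),
      show Real.sqrt 4 = 2 by rw [show (4 : ℝ) = 2 ^ 2 by norm_num]; exact Real.sqrt_sq (by norm_num)]
    rw [environmentMap_apply] at hb
    linarith
  rw [e1, e2, e3, e4]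
  set F := Real.sqrt (fisherInfo (pureState χ) (XB' ⊗ₖ (1 : Matrix R' R' ℂ)))
  have hF0 : 0 ≤ F := Real.sqrt_nonneg _
  -- `D` merely enlarges the denominator. A zero denominator is harmless: the quotient is then 0 and
  -- `δ` is nonnegative.
  have hle : δ * (2 * F) ≤ δ * (2 * (F + D)) :=
    mul_le_mul_of_nonneg_left (by linarith) hδ0
  exact ⟨hδ', hsum', hterm', hD', ⟨_, tendsto_fisherQuotient_pureState hχ1 hXk⟩,
    div_le_of_le_mul₀ (by positivity) hδ0 (by linarith),
    div_le_of_le_mul₀ (by positivity) hδ0 (by linarith)⟩
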